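/- **Setting.** Let $\Omega\subset\mathbb R^n$ be open, with balls $B(y,r)=\{z\in\Omega:|z-y|<r\}$ for $y\in\Omega$, $r>0$, and assume that $\Omega$ is doubling: $|B(y,2r)|\le D\,|B(y,r)|$ for all $y\in\Omega$, $r>0$. Let $L$ be a non-negative self-adjoint operator on $L^2(\Omega)$ (complex-valued functions) with spectral resolution $L=\int_0^\infty\lambda\,dE_L(\lambda)$, such that for every $t>0$ the operator $e^{-tL}$ has an integral kernel $p_t(x,y)$ (the heat kernel), and $|p_t(x,y)|\le C\,t^{-n/2}e^{-b|x-y|^2/t}$ for some $C,b>0$ and all $t>0$, $x,y\in\Omega$. For a bounded Borel function $F:[0,\infty)\to\mathbb C$ put $F(L)=\int_0^\infty F(\lambda)\,dE_L(\lambda)$. A measurable $K:\Omega^2\to\mathbb C$ is the kernel of a bounded operator $S$ on $L^2(\Omega)$ if $$\int_\Omega S\varphi\,\overline{\psi}\,dx=\int_\Omega\int_\Omega K(x,y)\varphi(y)\overline{\psi(x)}\,dy\,dx ,$$ with absolute convergence on the right, for all $\varphi,\psi\in C_c(\Omega)$ with disjoint supports. Let $\mathcal M(\Omega)$ be the set of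 $f\in L^1_{\rm loc}(\Omega)$ with $\int_\Omega |f(x)|^2(1+|x|^{n+d})^{-1}dx<\infty$ for some $d>0$; for such $f$ let $e^{-tL}f(x)=\int_\Omega p_t(x,y)f(y)\,dy$, and let $\mathrm{BMO}_L(\Omega)$ be the set of $f\in\mathcal M(\Omega)$ with $$\|f\|_{\mathrm{BMO}_L}=\sup_{y\in\Omega,\,r>0}\frac1{|B(y,r)|}\int_{B(y,r)}|f(x)-e^{-r^2L}f(x)|\,dx<\infty .$$ For a bounded Borel function $G$ on $[0,\infty)$ we write $\|G(L)\|_{L^\infty\to \mathrm{BMO}_L}\le A$ if * for all $f\in L^2(\Omega)\cap L^\infty(\Omega)$: $G(L)f\in\mathrm{BMO}_L(\Omega)$ and $\|G(L)f\|_{\mathrm{BMO}_L}\le A\|f\|_{L^\infty}$; * for all $f\in L^\infty(\Omega)$: for each $r>0$ the function $h_r=(I-e^{-r^2L})G(L)f$ is well defined, as the limit of $G(L)(I-e^{-r^2L})u_k$ in $L^1$ on every bounded part of $\Omega$, the same for all uniformly bounded sequences $u_k\in L^2(\Omega)$ converging to $f$ almost everywhere; and $\sup_{y\in\Omega,\,r>0}|B(y,r)|^{-1}\int_{B(y,r)}|h_r(x)|\,dx\le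 A\|f\|_{L^\infty}$. **Theorem 7.1.** For every $D$ there is a constant $c>0$, depending only on $D$, such that the following holds in the above setting. Let $F:[0,\infty)\to\mathbb C$ be Borel with $|F|\le C_1$ everywhere, and suppose that for every $r>0$ the operator $F(L)(I-e^{-r^2L})$ has a kernel $K_{F(L)(I-e^{-r^2L})}$ and that $$\sup_{r>0}\ \sup_{y\in\Omega}\int_{\Omega\setminus B(y,r)}\bigl|K_{F(L)(I-e^{-r^2L})}(x,y)\bigr|\,dx\le C_1 .$$ Then: 1. if the heat kernel $p_t(x,y)$ is real-valued, or $F$ is real-valued, then $\|F(L)\|_{L^\infty\to\mathrm{BMO}_L}\le c\,C_1$; 2. in every case, the adjoint $\overline F(L)=F(L)^*$ satisfies $\|\overline F(L)\|_{L^\infty\to\mathrm{BMO}_L}\le c\,C_1$. Part 2 applied to $\overline F$ says that $\|F(L)\|_{L^\infty\to\mathrm{BMO}_L}\le c\,C_1$ whenever the kernel bound holds with $K(y,x)$ in place of $K(x,y)$. -/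

import Mathlib

open MeasureTheory Filter Topology Set
open scoped NNReal ENNReal ComplexConjugate

noncomputable section

/-! ### Spectral resolutions and the functional calculus -/

/-- A projection-valued Borel measure on `[0, ∞)` acting on the Hilbert space `H`
(countable additivity is in the strong operator topology). -/
structure SpectralFamily (H : Type*) [NormedAddCommGroup H] [InnerProductSpace ℂ H]
    [CompleteSpace H] where
  proj : Set ℝ≥0 → (H →L[ℂ] H)
  isSelfAdjoint' : ∀ s, MeasurableSet s → IsSelfAdjoint (proj s)
  inter' : ∀ s t, MeasurableSet s → MeasurableSet t → proj (s ∩ t) = proj s * proj t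
  univ' : proj Set.univ = 1
  hasSum' : ∀ s : ℕ → Set ℝ≥0, (∀ i, MeasurableSet (s i)) → Pairwise (Function.onFun Disjoint s) →
    ∀ f : H, HasSum (fun i => proj (s i) f) (proj (⋃ i, s i) f)

namespace SpectralFamily

variable {H : Type*} [NormedAddCommGroup H] [InnerProductSpace ℂ H] [CompleteSpace H]

theorem proj_empty (E : SpectralFamily H) (f : H) : E.proj ∅ f = 0 := by
  have h := (E.hasSum' (fun _ => ∅) (fun _ => MeasurableSet.empty)
    (fun i j _ => by simp [Function.onFun]) f).summable
  exact (summable_const_iff _).1 h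

theorem inner_proj_self (E : SpectralFamily H) {s : Set ℝ≥0} (hs : MeasurableSet s) (f : H) :
    inner ℂ f (E.proj s f) = ((‖E.proj s f‖ ^ 2 : ℝ) : ℂ) := by
  have h1 : E.proj s f = E.proj s (E.proj s f) := by
    conv_lhs => rw [← Set.inter_self s, E.inter' s s hs hs]
    rfl
  have h2 : inner ℂ f (E.proj s (E.proj s f)) = inner ℂ (E.proj s f) (E.proj s f) := by
    rw [← ContinuousLinearMap.adjoint_inner_left, (E.isSelfAdjoint' s hs).adjoint_eq]
  rw [h1, h2, ← h1, inner_self_eq_norm_sq_to_K]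
  push_cast
  rfl

theorem norm_sq_hasSum (E : SpectralFamily H) (f : H) (s : ℕ → Set ℝ≥0)
    (hs : ∀ i, MeasurableSet (s i)) (hd : Pairwise (Function.onFun Disjoint s)) :
    HasSum (fun i => ‖E.proj (s i) f‖ ^ 2) (‖E.proj (⋃ i, s i) f‖ ^ 2) := by
  have h := (E.hasSum' s hs hd f).mapL (innerSL ℂ f)
  simp only [innerSL_apply_apply] at h
  rw [E.inner_proj_self (MeasurableSet.iUnion hs)] at h
  simp only [E.inner_proj_self (hs _)] at h
  exact Complex.hasSum_ofReal.1 h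

/-- The scalar spectral measure `s ↦ ⟨E(s) f, f⟩ = ‖E(s) f‖²`. -/
def scalarMeasure (E : SpectralFamily H) (f : H) : Measure ℝ≥0 :=
  Measure.ofMeasurable (fun s _ => ENNReal.ofReal (‖E.proj s f‖ ^ 2))
    (by simp [E.proj_empty])
    (by
      intro s hs hd
      have h := E.norm_sq_hasSum f s hs hd
      rw [← h.tsum_eq]
      exact ENNReal.ofReal_tsum_of_nonneg (fun _ => by positivity) h.summable)

/-- `∫ F dE`: the bounded operator `T` with `⟨T f, f⟩ = ∫ F(λ) d⟨E(λ) f, f⟩` for all `f`.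
(On a complex Hilbert space there is at most one; for bounded Borel `F` there is one.) -/
def integral (E : SpectralFamily H) (F : ℝ≥0 → ℂ) : H →L[ℂ] H :=
  open scoped Classical in
  if h : ∃ T : H →L[ℂ] H, ∀ f, inner ℂ f (T f) = ∫ l, F l ∂(E.scalarMeasure f)
  then h.choose else 0

/-- `E` is the spectral resolution of `L`, that is `L = ∫ λ dE(λ)` as an unbounded operator:
the domain of `L` consists of all `f` with `∫ λ² d⟨E f, f⟩ < ∞`, and
`⟨L f, f⟩ = ∫ λ d⟨E f, f⟩` on it. -/
def IsResolutionOf (E : SpectralFamily H) (L : H →ₗ.[ℂ] H) : Prop :=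
  (∀ f : H, f ∈ L.domain ↔ ∫⁻ l, (l : ℝ≥0∞) ^ 2 ∂(E.scalarMeasure f) < ⊤) ∧
  ∀ f : L.domain, inner ℂ (f : H) (L f) = ((∫ l, (l : ℝ) ∂(E.scalarMeasure (f : H)) : ℝ) : ℂ)

end SpectralFamily

/-- `F(L) = ∫₀^∞ F(λ) dE_L(λ)` where `E_L` is the spectral resolution of `L`. By the spectral
theorem, `E_L` exists and is unique when `L` is self-adjoint and non-negative; for other `L` without
a resolution on `[0, ∞)` the value is `0`. -/
def multiplier {H : Type*} [NormedAddCommGroup H] [InnerProductSpace ℂ H] [CompleteSpace H]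
    (L : H →ₗ.[ℂ] H) (F : ℝ≥0 → ℂ) : H →L[ℂ] H :=
  open scoped Classical in
  if h : ∃ E : SpectralFamily H, E.IsResolutionOf L then h.choose.integral F else 0

/-- The semigroup `e^{-tL}`. -/
def heatSemigroup {H : Type*} [NormedAddCommGroup H] [InnerProductSpace ℂ H] [CompleteSpace H]
    (L : H →ₗ.[ℂ] H) (t : ℝ) : H →L[ℂ] H :=
  multiplier L (fun l => Complex.exp (-(t * (l : ℝ) : ℝ)))

/-! ### Function spaces on an open subset of `ℝⁿ` -/

/-- Lebesgue measure on `Ω ⊆ ℝⁿ`. -/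
abbrev lebesgueOn {n : ℕ} (Ω : Set (EuclideanSpace ℝ (Fin n))) :
    Measure (EuclideanSpace ℝ (Fin n)) := volume.restrict Ω

/-- The Hilbert space `L²(Ω)` of complex-valued functions. -/
abbrev L2 {n : ℕ} (Ω : Set (EuclideanSpace ℝ (Fin n))) := Lp ℂ 2 (lebesgueOn Ω)

/-- The ball `B(y, r)` of `Ω` for the Euclidean distance restricted to `Ω`. -/
def ballIn {n : ℕ} (Ω : Set (EuclideanSpace ℝ (Fin n))) (y : EuclideanSpace ℝ (Fin n)) (r : ℝ) :
    Set (EuclideanSpace ℝ (Fin n)) := Ω ∩ Metric.ball y r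

/-- `Ω` with the Euclidean distance and Lebesgue measure is a space of homogeneous type, with
doubling constant `D`. -/
def IsDoubling {n : ℕ} (Ω : Set (EuclideanSpace ℝ (Fin n))) (D : ℝ) : Prop :=
  ∀ y ∈ Ω, ∀ r : ℝ, 0 < r → volume (ballIn Ω y (2 * r)) ≤ ENNReal.ofReal D * volume (ballIn Ω y r)

/-- `p` is the heat kernel of `L`: for every `t > 0` the operator `e^{-tL}` on `L²(Ω)` is the
integral operator with kernel `p t`. -/
def IsHeatKernel {n : ℕ} (Ω : Set (EuclideanSpace ℝ (Fin n))) (L : L2 Ω →ₗ.[ℂ] L2 Ω)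
    (p : ℝ → EuclideanSpace ℝ (Fin n) → EuclideanSpace ℝ (Fin n) → ℂ) : Prop :=
  ∀ t : ℝ, 0 < t →
    AEStronglyMeasurable (Function.uncurry (p t)) ((lebesgueOn Ω).prod (lebesgueOn Ω)) ∧
    ∀ u : L2 Ω, (heatSemigroup L t u : EuclideanSpace ℝ (Fin n) → ℂ) =ᵐ[lebesgueOn Ω]
      fun x => ∫ y in Ω, p t x y * u y

/-- The Gaussian upper bound `|p_t(x,y)| ≤ C t^{-n/2} exp(-c |x-y|² / t)` on `Ω`. -/
def HasGaussianBound {n : ℕ} (Ω : Set (EuclideanSpace ℝ (Fin n)))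
    (p : ℝ → EuclideanSpace ℝ (Fin n) → EuclideanSpace ℝ (Fin n) → ℂ) : Prop :=
  ∃ C c : ℝ, 0 < C ∧ 0 < c ∧ ∀ t : ℝ, 0 < t → ∀ x ∈ Ω, ∀ y ∈ Ω,
    ‖p t x y‖ ≤ C / t ^ ((n : ℝ) / 2) * Real.exp (-(c * (‖x - y‖ ^ 2 / t)))

/-- The action of `e^{-tL}` on functions on `Ω`, through the heat kernel `p`. -/
def heatAction {n : ℕ} (Ω : Set (EuclideanSpace ℝ (Fin n)))
    (p : ℝ → EuclideanSpace ℝ (Fin n) → EuclideanSpace ℝ (Fin n) → ℂ) (t : ℝ)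
    (f : EuclideanSpace ℝ (Fin n) → ℂ) (x : EuclideanSpace ℝ (Fin n)) : ℂ :=
  ∫ y in Ω, p t x y * f y

/-- The class `𝓜(Ω)` of all `f ∈ L¹_loc(Ω)` such that `∫_Ω |f(x)|² / (1 + |x|^{n+d}) dx < ∞` for
some `d > 0`. -/
def InGrowthClass {n : ℕ} (Ω : Set (EuclideanSpace ℝ (Fin n)))
    (f : EuclideanSpace ℝ (Fin n) → ℂ) : Prop :=
  LocallyIntegrableOn f Ω volume ∧ ∃ d : ℝ, 0 < d ∧
    IntegrableOn (fun x => ‖f x‖ ^ 2 / (1 + ‖x‖ ^ ((n : ℝ) + d))) Ω volume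

/-- The supremum over all balls `B(y, r)` of `Ω` of the averages over `B(y, r)` of `|h r|`, for a
family of functions `h r` indexed by the radius. -/
def ballMeanSup {n : ℕ} (Ω : Set (EuclideanSpace ℝ (Fin n)))
    (h : ℝ → EuclideanSpace ℝ (Fin n) → ℂ) : ℝ≥0∞ :=
  ⨆ y ∈ Ω, ⨆ r : ℝ, ⨆ _ : 0 < r,
    (∫⁻ x in ballIn Ω y r, ‖h r x‖ₑ) / volume (ballIn Ω y r)

/-- The seminorm of `BMO_L(Ω)`:
`sup_{B(y,r)} |B(y,r)|⁻¹ ∫_{B(y,r)} |f(x) - exp(-r²L) f(x)| dx`. -/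
def bmoSeminorm {n : ℕ} (Ω : Set (EuclideanSpace ℝ (Fin n)))
    (p : ℝ → EuclideanSpace ℝ (Fin n) → EuclideanSpace ℝ (Fin n) → ℂ)
    (f : EuclideanSpace ℝ (Fin n) → ℂ) : ℝ≥0∞ :=
  ballMeanSup Ω (fun r x => f x - heatAction Ω p (r ^ 2) f x)

/-- Membership in `BMO_L(Ω)`. -/
def InBMO {n : ℕ} (Ω : Set (EuclideanSpace ℝ (Fin n)))
    (p : ℝ → EuclideanSpace ℝ (Fin n) → EuclideanSpace ℝ (Fin n) → ℂ)
    (f : EuclideanSpace ℝ (Fin n) → ℂ) : Prop :=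
  InGrowthClass Ω f ∧ bmoSeminorm Ω p f < ⊤

/-- `K` is the (singular) kernel of the bounded operator `S` on `L²(Ω)`:
`∫_Ω S φ(x) conj(ψ(x)) dx = ∫_Ω ∫_Ω K(x,y) φ(y) conj(ψ(x)) dy dx`, the integral being absolutely
convergent, for all `φ, ψ ∈ C_c(Ω)` with disjoint supports. -/
def IsSingularKernel {n : ℕ} (Ω : Set (EuclideanSpace ℝ (Fin n))) (S : L2 Ω →L[ℂ] L2 Ω)
    (K : EuclideanSpace ℝ (Fin n) → EuclideanSpace ℝ (Fin n) → ℂ) : Prop :=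
  AEStronglyMeasurable (Function.uncurry K) ((lebesgueOn Ω).prod (lebesgueOn Ω)) ∧
  ∀ φ ψ : EuclideanSpace ℝ (Fin n) → ℂ,
    Continuous φ → HasCompactSupport φ → tsupport φ ⊆ Ω →
    Continuous ψ → HasCompactSupport ψ → tsupport ψ ⊆ Ω →
    Disjoint (tsupport φ) (tsupport ψ) →
    Integrable (fun z : EuclideanSpace ℝ (Fin n) × EuclideanSpace ℝ (Fin n) =>
      K z.1 z.2 * φ z.2 * conj (ψ z.1)) ((lebesgueOn Ω).prod (lebesgueOn Ω)) ∧
    ∀ u : L2 Ω, u =ᵐ[lebesgueOn Ω] φ →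
      ∫ x in Ω, S u x * conj (ψ x) = ∫ x in Ω, ∫ y in Ω, K x y * φ y * conj (ψ x)

/-- `h` is the value `S f` of the extension of `S` to the bounded function `f`: whenever
`u k ∈ L²(Ω)` is a uniformly bounded sequence converging to `f` almost everywhere (for instance the
truncations of `f` to the balls of radius `k` about the origin), `S (u k)` converges to `h` in `L¹`
on every bounded part of `Ω`. -/
def IsBoundedExtensionValue {n : ℕ} (Ω : Set (EuclideanSpace ℝ (Fin n)))
    (S : L2 Ω →L[ℂ] L2 Ω) (f h : EuclideanSpace ℝ (Fin n) → ℂ) : Prop :=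
  AEStronglyMeasurable h (lebesgueOn Ω) ∧
  ∀ u : ℕ → L2 Ω, (∃ M : ℝ, ∀ k, ∀ᵐ x ∂(lebesgueOn Ω), ‖u k x‖ ≤ M) →
    (∀ᵐ x ∂(lebesgueOn Ω), Tendsto (fun k => u k x) atTop (𝓝 (f x))) →
    ∀ R : ℝ, Tendsto (fun k => ∫⁻ x in ballIn Ω 0 R, ‖S (u k) x - h x‖ₑ) atTop (𝓝 0)

/-- `‖F(L)‖_{L^∞ → BMO_L} ≤ A`.

* For `f ∈ L²(Ω) ∩ L^∞(Ω)`, where `F(L) f` is given by the functional calculus: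
  `F(L) f ∈ BMO_L(Ω)` and `‖F(L) f‖_{BMO_L} ≤ A ‖f‖_∞`.
* For an arbitrary `f ∈ L^∞(Ω)`: for every `r > 0` the function
  `h r = (I - e^{-r²L}) F(L) f` is well defined, as the value at `f` of the extension of the operator
  `F(L) (I - e^{-r²L})`, and `sup_{B(y,r)} |B(y,r)|⁻¹ ∫_{B(y,r)} |h r| ≤ A ‖f‖_∞`. -/
def LinftyToBMOBound {n : ℕ} (Ω : Set (EuclideanSpace ℝ (Fin n))) (L : L2 Ω →ₗ.[ℂ] L2 Ω)
    (p : ℝ → EuclideanSpace ℝ (Fin n) → EuclideanSpace ℝ (Fin n) → ℂ)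
    (F : ℝ≥0 → ℂ) (A : ℝ) : Prop :=
  (∀ f : L2 Ω, MemLp f ⊤ (lebesgueOn Ω) →
    InBMO Ω p (multiplier L F f) ∧
    bmoSeminorm Ω p (multiplier L F f) ≤ ENNReal.ofReal A * eLpNorm f ⊤ (lebesgueOn Ω)) ∧
  ∀ f : EuclideanSpace ℝ (Fin n) → ℂ, MemLp f ⊤ (lebesgueOn Ω) →
    ∃ h : ℝ → EuclideanSpace ℝ (Fin n) → ℂ,
      (∀ r : ℝ, 0 < r → IsBoundedExtensionValue Ω
        (multiplier L F * (1 - heatSemigroup L (r ^ 2))) f (h r)) ∧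
      ballMeanSup Ω h ≤ ENNReal.ofReal A * eLpNorm f ⊤ (lebesgueOn Ω)

end

noncomputable section

/-! ### Functional calculus of a projection-valued measure -/

/-! Put `S = F(L)(I - e^{-r²L})`. Its adjoint is `F̄(L)(I - e^{-r²L})`, with kernel `conj K(z,x)`,
so the column bound on `K` controls exactly the integrals that define `S†` on bounded functions.
This is why the adjoint is the natural operator to estimate and part 2 comes first. Fix a ball `B =
B(y,r)` and split a bounded `u` at distance `2r` from `y`. The near part has `L²` norm at most
`‖u‖_∞ |B(y,2r)|^{1/2}`; since `‖S‖ ≤ 2C₁`, Cauchy–Schwarz and doubling give a contribution of at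
most `2C₁ √D ‖u‖_∞ |B|`. A point `z` of the far part is at distance at least `r` from every `x ∈ B`,
so Tonelli and the column bound give at most `C₁ ‖u‖_∞ |B|`. The sum is
`HasOffDiagonalKernel.lintegral_adjoint_le`, whence `c = 2√D + 1`. The same splitting on balls about
the origin extends `S†` to bounded functions: dominated convergence handles the near part in `L²`,
and the far part because `K` is integrable on far set times ball
(`HasOffDiagonalKernel.exists_isBoundedExtensionValue`). Part 1 reduces to part 2. If `F` is real,
then `F̄ = F`. If the heat kernel is real, complex conjugation `J` commutes with the semigroup;
finite measures are determined by their Laplace transforms, so `u` and `Ju` have the same spectral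
measure and `F(L) = J F̄(L) J` (`IsHeatKernel.multiplier_star`). All the bounds are invariant under
`J`. -/

/-- Polarization over `ℂ`. Since `integral` is specified only by its quadratic form, this is the
means of identifying it. -/
theorem ContinuousLinearMap.eq_of_inner_self_eq {H : Type*} [NormedAddCommGroup H]
    [InnerProductSpace ℂ H] {T S : H →L[ℂ] H}
    (h : ∀ f, inner ℂ f (T f) = inner ℂ f (S f)) : T = S := by
  have : (T : H →ₗ[ℂ] H) = (S : H →ₗ[ℂ] H) := by
    rw [← ext_inner_map]
    intro x
    have := congrArg conj (h x)
    simp only [inner_conj_symm] at this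
    exact this
  exact ContinuousLinearMap.coe_injective this

namespace SpectralFamily

variable {H : Type*} [NormedAddCommGroup H] [InnerProductSpace ℂ H] [CompleteSpace H]

theorem scalarMeasure_apply (E : SpectralFamily H) (f : H) {s : Set ℝ≥0} (hs : MeasurableSet s) :
    E.scalarMeasure f s = ENNReal.ofReal (‖E.proj s f‖ ^ 2) :=
  Measure.ofMeasurable_apply s hs

theorem scalarMeasure_univ (E : SpectralFamily H) (f : H) :
    E.scalarMeasure f univ = ENNReal.ofReal (‖f‖ ^ 2) := by
  rw [E.scalarMeasure_apply f MeasurableSet.univ, E.univ']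
  rfl

instance (E : SpectralFamily H) (f : H) : IsFiniteMeasure (E.scalarMeasure f) :=
  ⟨by rw [E.scalarMeasure_univ]; exact ENNReal.ofReal_lt_top⟩

theorem scalarMeasure_real (E : SpectralFamily H) (f : H) {s : Set ℝ≥0} (hs : MeasurableSet s) :
    (E.scalarMeasure f).real s = ‖E.proj s f‖ ^ 2 := by
  rw [measureReal_def, E.scalarMeasure_apply f hs, ENNReal.toReal_ofReal (by positivity)]

theorem scalarMeasure_real_univ (E : SpectralFamily H) (f : H) :
    (E.scalarMeasure f).real univ = ‖f‖ ^ 2 := by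
  rw [measureReal_def, E.scalarMeasure_univ f, ENNReal.toReal_ofReal (by positivity)]

/-- `T = ∫ F dE` in the weak sense. -/
def IsIntegral (E : SpectralFamily H) (F : ℝ≥0 → ℂ) (T : H →L[ℂ] H) : Prop :=
  ∀ f, inner ℂ f (T f) = ∫ l, F l ∂(E.scalarMeasure f)

theorem IsIntegral.unique {E : SpectralFamily H} {F : ℝ≥0 → ℂ} {T S : H →L[ℂ] H}
    (hT : E.IsIntegral F T) (hS : E.IsIntegral F S) : T = S :=
  ContinuousLinearMap.eq_of_inner_self_eq fun f => (hT f).trans (hS f).symm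

theorem IsIntegral.integral_eq {E : SpectralFamily H} {F : ℝ≥0 → ℂ} {T : H →L[ℂ] H}
    (hT : E.IsIntegral F T) : E.integral F = T := by
  have hex : ∃ T : H →L[ℂ] H, ∀ f, inner ℂ f (T f) = ∫ l, F l ∂(E.scalarMeasure f) := ⟨T, hT⟩
  have : E.IsIntegral F (E.integral F) := by
    unfold SpectralFamily.integral
    rw [dif_pos hex]
    exact hex.choose_spec
  exact this.unique hT

/-- The integral of a simple function. -/
def simpleIntegral (E : SpectralFamily H) (s : SimpleFunc ℝ≥0 ℂ) : H →L[ℂ] H :=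
  ∑ z ∈ s.range, z • E.proj (s ⁻¹' {z})

theorem simpleIntegral_apply (E : SpectralFamily H) (s : SimpleFunc ℝ≥0 ℂ) (f : H) :
    E.simpleIntegral s f = ∑ z ∈ s.range, z • E.proj (s ⁻¹' {z}) f := by
  simp [simpleIntegral]

theorem simpleFunc_integrable (E : SpectralFamily H) (s : SimpleFunc ℝ≥0 ℂ) (f : H) :
    Integrable s (E.scalarMeasure f) :=
  SimpleFunc.integrable_of_isFiniteMeasure s

theorem isIntegral_simpleIntegral (E : SpectralFamily H) (s : SimpleFunc ℝ≥0 ℂ) :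
    E.IsIntegral s (E.simpleIntegral s) := by
  intro f
  rw [SimpleFunc.integral_eq_sum s (E.simpleFunc_integrable s f), simpleIntegral_apply, inner_sum]
  refine Finset.sum_congr rfl fun z _ => ?_
  rw [inner_smul_right, E.inner_proj_self (s.measurableSet_fiber z),
    E.scalarMeasure_real f (s.measurableSet_fiber z), Complex.real_smul, mul_comm]

/-- Comparing quadratic forms avoids a common refinement of the two partitions. -/
theorem simpleIntegral_sub (E : SpectralFamily H) (s t : SimpleFunc ℝ≥0 ℂ) :
    E.simpleIntegral (s - t) = E.simpleIntegral s - E.simpleIntegral t := by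
  refine (E.isIntegral_simpleIntegral (s - t)).unique fun f => ?_
  rw [sub_apply, inner_sub_right, E.isIntegral_simpleIntegral s f,
    E.isIntegral_simpleIntegral t f,
    ← integral_sub (E.simpleFunc_integrable s f) (E.simpleFunc_integrable t f)]
  rfl

theorem inner_proj_proj_of_disjoint (E : SpectralFamily H) {s t : Set ℝ≥0} (hs : MeasurableSet s)
    (ht : MeasurableSet t) (hd : Disjoint s t) (f : H) :
    inner ℂ (E.proj s f) (E.proj t f) = 0 := by
  rw [← (E.isSelfAdjoint' s hs).adjoint_eq, ContinuousLinearMap.adjoint_inner_left]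
  have : E.proj s (E.proj t f) = E.proj (s ∩ t) f := by rw [E.inter' s t hs ht]; rfl
  rw [this, hd.inter_eq, E.proj_empty, inner_zero_right]

/-- Pythagoras: distinct fibres are disjoint, so their projections have orthogonal ranges. This
isometry yields both the strong convergence and the norm bound of the calculus. -/
theorem norm_simpleIntegral_sq (E : SpectralFamily H) (s : SimpleFunc ℝ≥0 ℂ) (f : H) :
    ‖E.simpleIntegral s f‖ ^ 2 = ∫ l, ‖s l‖ ^ 2 ∂(E.scalarMeasure f) := by
  have h1 : (∫ l, ‖s l‖ ^ 2 ∂(E.scalarMeasure f)) =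
      ∑ z ∈ s.range, ‖E.proj (s ⁻¹' {z}) f‖ ^ 2 * ‖z‖ ^ 2 := by
    have h := SimpleFunc.map_integral (μ := E.scalarMeasure f) s (fun z => ‖z‖ ^ 2)
      (E.simpleFunc_integrable s f) (by simp)
    rw [SimpleFunc.integral_eq_integral _ (SimpleFunc.integrable_of_isFiniteMeasure _)] at h
    simp only [SimpleFunc.coe_map, Function.comp_apply] at h
    rw [h]
    refine Finset.sum_congr rfl fun z _ => ?_
    rw [E.scalarMeasure_real f (s.measurableSet_fiber z), smul_eq_mul]
  have h2 : ((‖E.simpleIntegral s f‖ ^ 2 : ℝ) : ℂ) =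
      ∑ z ∈ s.range, ((‖E.proj (s ⁻¹' {z}) f‖ ^ 2 * ‖z‖ ^ 2 : ℝ) : ℂ) := by
    push_cast
    rw [← Complex.coe_algebraMap, ← inner_self_eq_norm_sq_to_K (𝕜 := ℂ), simpleIntegral_apply,
      sum_inner]
    refine Finset.sum_congr rfl fun z hz => ?_
    rw [inner_sum, Finset.sum_eq_single z]
    · rw [inner_smul_left, inner_smul_right, inner_self_eq_norm_sq_to_K, Complex.coe_algebraMap,
        ← mul_assoc, Complex.conj_mul', mul_comm]
      rfl
    · intro w _ hw
      rw [inner_smul_left, inner_smul_right, E.inner_proj_proj_of_disjoint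
        (s.measurableSet_fiber z) (s.measurableSet_fiber w)
        ((disjoint_singleton.2 hw.symm).preimage _)]
      simp
    · exact fun h => absurd hz h
  rw [h1]
  exact_mod_cast h2

theorem simpleIntegral_commute (E : SpectralFamily H) (s : SimpleFunc ℝ≥0 ℂ) {W : H →L[ℂ] H}
    (hW : ∀ t, MeasurableSet t → Commute W (E.proj t)) : Commute W (E.simpleIntegral s) := by
  unfold simpleIntegral
  exact Commute.sum_right _ _ _ fun z _ => (hW _ (s.measurableSet_fiber z)).smul_right z

/-- Bounded pointwise convergence of simple functions gives strong convergence of integrals. -/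
theorem cauchySeq_simpleIntegral (E : SpectralFamily H) {F : ℝ≥0 → ℂ} {C : ℝ} (hF : Measurable F)
    (hC : ∀ l, ‖F l‖ ≤ C) {s : ℕ → SimpleFunc ℝ≥0 ℂ} (hs : ∀ n l, ‖s n l‖ ≤ C)
    (hlim : ∀ l, Tendsto (fun n => s n l) atTop (𝓝 (F l))) (f : H) :
    CauchySeq fun n => E.simpleIntegral (s n) f := by
  set a : ℕ → ℝ := fun n => ∫ l, ‖s n l - F l‖ ^ 2 ∂(E.scalarMeasure f) with ha
  have hb : ∀ n l, ‖s n l - F l‖ ^ 2 ≤ (C + C) ^ 2 := fun n l => by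
    have := norm_sub_le_of_le (hs n l) (hC l)
    gcongr
  have hint : ∀ n, Integrable (fun l => ‖s n l - F l‖ ^ 2) (E.scalarMeasure f) := fun n =>
    Integrable.of_bound
      (((s n).measurable.sub hF).norm.pow_const 2).aestronglyMeasurable ((C + C) ^ 2)
      (ae_of_all _ fun l => by
        rw [Real.norm_of_nonneg (by positivity)]
        exact hb n l)
  have ha0 : Tendsto a atTop (𝓝 0) := by
    have := tendsto_integral_of_dominated_convergence (μ := E.scalarMeasure f)
      (F := fun n l => ‖s n l - F l‖ ^ 2) (f := fun _ => 0) (fun _ => (C + C) ^ 2)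
      (fun n => (hint n).aestronglyMeasurable) (integrable_const _)
      (fun n => ae_of_all _ fun l => by
        rw [Real.norm_of_nonneg (by positivity)]
        exact hb n l)
      (ae_of_all _ fun l => by
        have := ((hlim l).sub_const (F l)).norm.pow 2
        simpa using this)
    simpa using this
  have hkey : ∀ n m, ‖E.simpleIntegral (s n) f - E.simpleIntegral (s m) f‖ ^ 2 ≤
      2 * a n + 2 * a m := by
    intro n m
    rw [← sub_apply, ← simpleIntegral_sub, norm_simpleIntegral_sq, ha]
    simp only
    rw [← integral_const_mul, ← integral_const_mul,
      ← integral_add ((hint n).const_mul 2) ((hint m).const_mul 2)]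
    refine integral_mono_of_nonneg (ae_of_all _ fun l => by positivity)
      (((hint n).const_mul 2).add ((hint m).const_mul 2)) (ae_of_all _ fun l => ?_)
    have h := norm_sub_le (s n l - F l) (s m l - F l)
    simp only [sub_sub_sub_cancel_right] at h
    simp only [SimpleFunc.coe_sub, Pi.sub_apply]
    nlinarith [sq_nonneg (‖s n l - F l‖ - ‖s m l - F l‖), norm_nonneg (s n l - s m l)]
  rw [Metric.cauchySeq_iff']
  -- With both errors below `ε²/4`, the bound `2 a n + 2 a N` stays below `ε²`.
  intro ε hε
  obtain ⟨N, hN⟩ := (ha0.eventually (gt_mem_nhds (show (0 : ℝ) < ε ^ 2 / 4 by positivity))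
    ).exists_forall_of_atTop
  refine ⟨N, fun n hn => ?_⟩
  rw [dist_eq_norm]
  refine lt_of_pow_lt_pow_left₀ 2 hε.le ((hkey n N).trans_lt ?_)
  linarith [hN n hn, hN N le_rfl]

/-- The functional calculus of bounded Borel functions: the integral exists, and is a strong limit
of integrals of simple functions with the same bound. -/
theorem exists_isIntegral (E : SpectralFamily H) {F : ℝ≥0 → ℂ} {C : ℝ} (hF : Measurable F)
    (hC : ∀ l, ‖F l‖ ≤ C) :
    ∃ (T : H →L[ℂ] H) (s : ℕ → SimpleFunc ℝ≥0 ℂ), E.IsIntegral F T ∧ (∀ n l, ‖s n l‖ ≤ C) ∧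
      ∀ f, Tendsto (fun n => E.simpleIntegral (s n) f) atTop (𝓝 (T f)) := by
  have hC0 : 0 ≤ C := (norm_nonneg _).trans (hC 0)
  set s := hF.stronglyMeasurable.approxBounded C
  have hs : ∀ n l, ‖s n l‖ ≤ C := StronglyMeasurable.norm_approxBounded_le _ hC0
  have hlim : ∀ l, Tendsto (fun n => s n l) atTop (𝓝 (F l)) := fun l =>
    StronglyMeasurable.tendsto_approxBounded_of_norm_le _ (hC l)
  choose g hg using fun f => cauchySeq_tendsto_of_complete
    (E.cauchySeq_simpleIntegral hF hC hs hlim f)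
  -- By Banach–Steinhaus the pointwise limit is a bounded operator.
  refine ⟨continuousLinearMapOfTendsto (fun n => E.simpleIntegral (s n)) (tendsto_pi_nhds.2 hg), s,
    fun f => ?_, hs, hg⟩
  have h1 : Tendsto (fun n => inner ℂ f (E.simpleIntegral (s n) f)) atTop (𝓝 (inner ℂ f (g f))) :=
    tendsto_const_nhds.inner (hg f)
  have h2 : Tendsto (fun n => ∫ l, s n l ∂(E.scalarMeasure f)) atTop
      (𝓝 (∫ l, F l ∂(E.scalarMeasure f))) :=
    tendsto_integral_of_dominated_convergence (fun _ => C)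
      (fun n => (s n).measurable.aestronglyMeasurable) (integrable_const _)
      (fun n => ae_of_all _ (hs n)) (ae_of_all _ hlim)
  refine tendsto_nhds_unique h1 (h2.congr fun n => ?_)
  exact (E.isIntegral_simpleIntegral (s n) f).symm

theorem isIntegral_integral (E : SpectralFamily H) {F : ℝ≥0 → ℂ} {C : ℝ} (hF : Measurable F)
    (hC : ∀ l, ‖F l‖ ≤ C) : E.IsIntegral F (E.integral F) := by
  obtain ⟨T, _, hT, _⟩ := E.exists_isIntegral hF hC
  rwa [hT.integral_eq]

/-- A bound on the quadratic form of a general operator would lose a factor 2. The isometry for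
simple functions gives the sharp constant, which survives strong limits. -/
theorem norm_integral_le (E : SpectralFamily H) {F : ℝ≥0 → ℂ} {C : ℝ} (hF : Measurable F)
    (hC : ∀ l, ‖F l‖ ≤ C) : ‖E.integral F‖ ≤ C := by
  have hC0 : 0 ≤ C := (norm_nonneg _).trans (hC 0)
  obtain ⟨T, s, hT, hs, hlim⟩ := E.exists_isIntegral hF hC
  rw [hT.integral_eq]
  refine ContinuousLinearMap.opNorm_le_bound _ hC0 fun f => ?_
  refine le_of_tendsto (hlim f).norm (Eventually.of_forall fun n => ?_)
  refine le_of_sq_le_sq ?_ (by positivity)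
  rw [norm_simpleIntegral_sq, mul_pow, ← E.scalarMeasure_real_univ f]
  calc ∫ l, ‖s n l‖ ^ 2 ∂(E.scalarMeasure f) ≤ ∫ _, C ^ 2 ∂(E.scalarMeasure f) := by
        refine integral_mono_of_nonneg (ae_of_all _ fun l => by positivity) (integrable_const _)
          (ae_of_all _ fun l => ?_)
        have := hs n l
        simp only
        gcongr
    _ = C ^ 2 * (E.scalarMeasure f).real univ := by rw [integral_const, smul_eq_mul, mul_comm]

theorem adjoint_integral (E : SpectralFamily H) {F : ℝ≥0 → ℂ} {C : ℝ} (hF : Measurable F)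
    (hC : ∀ l, ‖F l‖ ≤ C) :
    ContinuousLinearMap.adjoint (E.integral F) = E.integral fun l => conj (F l) := by
  symm
  refine IsIntegral.integral_eq fun f => ?_
  rw [ContinuousLinearMap.adjoint_inner_right, ← inner_conj_symm, E.isIntegral_integral hF hC f,
    ← integral_conj]

theorem integral_commute_of_proj (E : SpectralFamily H) {F : ℝ≥0 → ℂ} {C : ℝ} (hF : Measurable F)
    (hC : ∀ l, ‖F l‖ ≤ C) {W : H →L[ℂ] H}
    (hW : ∀ t, MeasurableSet t → Commute W (E.proj t)) : Commute W (E.integral F) := by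
  obtain ⟨T, s, hT, hs, hlim⟩ := E.exists_isIntegral hF hC
  rw [hT.integral_eq]
  refine ContinuousLinearMap.ext fun f => ?_
  refine tendsto_nhds_unique ((W.continuous.tendsto _).comp (hlim f)) ((hlim (W f)).congr fun n => ?_)
  exact (DFunLike.congr_fun (E.simpleIntegral_commute (s n) hW) f).symm

/-- Multiplicativity of the calculus is not needed: projections commute because intersection is
symmetric, and strong limits pass this on to one integral and then to the other. -/
theorem integral_commute (E : SpectralFamily H) {F G : ℝ≥0 → ℂ} {C D : ℝ} (hF : Measurable F)
    (hC : ∀ l, ‖F l‖ ≤ C) (hG : Measurable G) (hD : ∀ l, ‖G l‖ ≤ D) :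
    Commute (E.integral F) (E.integral G) := by
  refine E.integral_commute_of_proj hG hD fun t ht => Commute.symm ?_
  refine E.integral_commute_of_proj hF hC fun s hs => ?_
  have h := (E.inter' t s ht hs).symm
  rw [inter_comm, E.inter' s t hs ht] at h
  exact h

end SpectralFamily

/-! ### Bounds, adjoints and commutation for multipliers of `L` -/

section Multiplier

variable {H : Type*} [NormedAddCommGroup H] [InnerProductSpace ℂ H] [CompleteSpace H]

/-- Either the multipliers are the integrals against one spectral family, or they all vanish. -/
theorem multiplier_eq_integral_or_zero (L : H →ₗ.[ℂ] H) :
    (∃ E : SpectralFamily H, ∀ F, multiplier L F = E.integral F) ∨ ∀ F, multiplier L F = 0 := by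
  by_cases h : ∃ E : SpectralFamily H, E.IsResolutionOf L
  · exact Or.inl ⟨h.choose, fun F => by unfold multiplier; rw [dif_pos h]⟩
  · exact Or.inr fun F => by unfold multiplier; rw [dif_neg h]

theorem norm_multiplier_le (L : H →ₗ.[ℂ] H) {F : ℝ≥0 → ℂ} {C : ℝ} (hF : Measurable F)
    (hC : ∀ l, ‖F l‖ ≤ C) : ‖multiplier L F‖ ≤ C := by
  obtain ⟨E, h⟩ | h := multiplier_eq_integral_or_zero L
  · rw [h]
    exact E.norm_integral_le hF hC
  · rw [h, norm_zero]
    exact (norm_nonneg _).trans (hC 0)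

theorem adjoint_multiplier (L : H →ₗ.[ℂ] H) {F : ℝ≥0 → ℂ} {C : ℝ} (hF : Measurable F)
    (hC : ∀ l, ‖F l‖ ≤ C) :
    ContinuousLinearMap.adjoint (multiplier L F) = multiplier L fun l => conj (F l) := by
  obtain ⟨E, h⟩ | h := multiplier_eq_integral_or_zero L
  · rw [h, h]
    exact E.adjoint_integral hF hC
  · rw [h, h, map_zero]

theorem multiplier_commute (L : H →ₗ.[ℂ] H) {F G : ℝ≥0 → ℂ} {C D : ℝ} (hF : Measurable F)
    (hC : ∀ l, ‖F l‖ ≤ C) (hG : Measurable G) (hD : ∀ l, ‖G l‖ ≤ D) :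
    Commute (multiplier L F) (multiplier L G) := by
  obtain ⟨E, h⟩ | h := multiplier_eq_integral_or_zero L
  · rw [h, h]
    exact E.integral_commute hF hC hG hD
  · rw [h, h]

theorem measurable_heatSymbol (t : ℝ) :
    Measurable fun l : ℝ≥0 => Complex.exp (-(t * (l : ℝ) : ℝ)) := by
  fun_prop

theorem norm_heatSymbol_le {t : ℝ} (ht : 0 ≤ t) (l : ℝ≥0) :
    ‖Complex.exp (-(t * (l : ℝ) : ℝ))‖ ≤ 1 := by
  rw [← Complex.ofReal_neg, Complex.norm_exp_ofReal, Real.exp_le_one_iff]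
  have := mul_nonneg ht l.2
  simp only [NNReal.val_eq_coe] at this
  linarith

theorem norm_heatSemigroup_le (L : H →ₗ.[ℂ] H) {t : ℝ} (ht : 0 ≤ t) : ‖heatSemigroup L t‖ ≤ 1 :=
  norm_multiplier_le L (measurable_heatSymbol t) (norm_heatSymbol_le ht)

theorem adjoint_heatSemigroup (L : H →ₗ.[ℂ] H) {t : ℝ} (ht : 0 ≤ t) :
    ContinuousLinearMap.adjoint (heatSemigroup L t) = heatSemigroup L t := by
  unfold heatSemigroup
  rw [adjoint_multiplier L (measurable_heatSymbol t) (norm_heatSymbol_le ht)]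
  congr 1
  funext l
  rw [← Complex.exp_conj, map_neg, Complex.conj_ofReal]

theorem multiplier_commute_heatSemigroup (L : H →ₗ.[ℂ] H) {F : ℝ≥0 → ℂ} {C : ℝ}
    (hF : Measurable F) (hC : ∀ l, ‖F l‖ ≤ C) {t : ℝ} (ht : 0 ≤ t) :
    Commute (multiplier L F) (1 - heatSemigroup L t) :=
  (Commute.one_right _).sub_right
    (multiplier_commute L hF hC (measurable_heatSymbol t) (norm_heatSymbol_le ht))

/-- The 2 comes from the triangle inequality for `1 - e^{-tL}` and reappears in the final constant.
-/
theorem norm_multiplier_mul_le (L : H →ₗ.[ℂ] H) {F : ℝ≥0 → ℂ} {C : ℝ} (hF : Measurable F)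
    (hC : ∀ l, ‖F l‖ ≤ C) {t : ℝ} (ht : 0 ≤ t) :
    ‖multiplier L F * (1 - heatSemigroup L t)‖ ≤ 2 * C := by
  have h1 : ‖(1 : H →L[ℂ] H) - heatSemigroup L t‖ ≤ 1 + 1 :=
    norm_sub_le_of_le ContinuousLinearMap.norm_id_le (norm_heatSemigroup_le L ht)
  have h2 := norm_multiplier_le L hF hC
  calc _ ≤ ‖multiplier L F‖ * ‖(1 : H →L[ℂ] H) - heatSemigroup L t‖ := norm_mul_le _ _
    _ ≤ C * (1 + 1) := by gcongr; exact (norm_nonneg _).trans (hC 0)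
    _ = 2 * C := by ring

/-- The adjoint reverses the factors; commutation restores their order. -/
theorem adjoint_multiplier_mul (L : H →ₗ.[ℂ] H) {F : ℝ≥0 → ℂ} {C : ℝ} (hF : Measurable F)
    (hC : ∀ l, ‖F l‖ ≤ C) {t : ℝ} (ht : 0 ≤ t) :
    ContinuousLinearMap.adjoint (multiplier L F * (1 - heatSemigroup L t)) =
      multiplier L (fun l => conj (F l)) * (1 - heatSemigroup L t) := by
  have h := congrArg ContinuousLinearMap.adjoint (multiplier_commute_heatSemigroup L hF hC ht).eq
  have h1 : ContinuousLinearMap.adjoint (1 : H →L[ℂ] H) = 1 := ContinuousLinearMap.adjoint_id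
  rw [h, ContinuousLinearMap.mul_def, ContinuousLinearMap.adjoint_comp, map_sub, h1,
    adjoint_heatSemigroup L ht, adjoint_multiplier L hF hC]
  rfl

end Multiplier

end

noncomputable section

/-! ### Adjoints of operators with a singular kernel -/

section SingularKernel

/-- Locally integrable functions on an open set that agree as distributions agree almost
everywhere. -/
theorem IsOpen.ae_eq_of_integral_contDiff_smul_eq {X : Type*} [NormedAddCommGroup X]
    [NormedSpace ℝ X] [FiniteDimensional ℝ X] [MeasurableSpace X] [BorelSpace X] {ν : Measure X}
    {U : Set X} (hU : IsOpen U) {f g : X → ℂ} (hf : LocallyIntegrable f (ν.restrict U))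
    (hg : LocallyIntegrable g (ν.restrict U))
    (h : ∀ χ : X → ℝ, Continuous χ → HasCompactSupport χ → tsupport χ ⊆ U →
      ∫ x in U, (χ x : ℂ) * f x ∂ν = ∫ x in U, (χ x : ℂ) * g x ∂ν) :
    f =ᵐ[ν.restrict U] g := by
  have : ∀ᵐ x ∂(ν.restrict U), x ∈ U → (f - g) x = 0 := by
    refine hU.ae_eq_zero_of_integral_contDiff_smul_eq_zero
      ((hf.sub hg).locallyIntegrableOn U) fun χ hχ hχc hχU => ?_
    simp only [Pi.sub_apply, smul_sub]
    rw [integral_sub (hf.integrable_smul_left_of_hasCompactSupport hχ.continuous hχc)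
      (hg.integrable_smul_left_of_hasCompactSupport hχ.continuous hχc), sub_eq_zero]
    simpa only [Complex.real_smul] using h χ hχ.continuous hχc hχU
  filter_upwards [this, ae_restrict_mem hU.measurableSet] with x hx hxU
  exact sub_eq_zero.1 (hx hxU)

variable {n : ℕ} {Ω U V : Set (EuclideanSpace ℝ (Fin n))}
  {K : EuclideanSpace ℝ (Fin n) → EuclideanSpace ℝ (Fin n) → ℂ} {S : L2 Ω →L[ℂ] L2 Ω}

theorem L2.memLp_restrict (hUΩ : U ⊆ Ω) (u : L2 Ω) : MemLp u 2 (volume.restrict U) :=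
  (Lp.memLp u).mono_measure (Measure.restrict_mono_set _ hUΩ)

theorem aestronglyMeasurable_kernel_restrict (hUΩ : U ⊆ Ω) (hVΩ : V ⊆ Ω)
    (hK : AEStronglyMeasurable (Function.uncurry K) ((lebesgueOn Ω).prod (lebesgueOn Ω))) :
    AEStronglyMeasurable (Function.uncurry K)
      (((volume : Measure (EuclideanSpace ℝ (Fin n))).restrict U).prod (volume.restrict V)) := by
  refine hK.mono_measure ?_
  rw [Measure.prod_restrict, Measure.prod_restrict]
  exact Measure.restrict_mono_set _ (prod_mono hUΩ hVΩ)

theorem lintegral_kernel_le {C : ℝ≥0∞} (hVm : MeasurableSet V)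
    (hK : AEStronglyMeasurable (Function.uncurry K)
      (((volume : Measure (EuclideanSpace ℝ (Fin n))).restrict U).prod (volume.restrict V)))
    (hC : ∀ y ∈ V, ∫⁻ x in U, ‖K x y‖ₑ ≤ C) :
    ∫⁻ z, ‖Function.uncurry K z‖ₑ
      ∂((volume : Measure (EuclideanSpace ℝ (Fin n))).restrict U).prod (volume.restrict V) ≤
      C * volume V := by
  rw [lintegral_prod_symm _ hK.enorm]
  calc _ ≤ ∫⁻ _ in V, C := setLIntegral_mono' hVm fun y hy => hC y hy
    _ = C * volume V := by rw [setLIntegral_const]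

/-- For `φ` supported in `V`, the function `S φ` is given by the kernel on `U`. -/
theorem IsSingularKernel.ae_eq_integral (hΩ : IsOpen Ω) (hU : IsOpen U) (hUΩ : U ⊆ Ω)
    (hVΩ : V ⊆ Ω) (hUV : Disjoint U V) (hS : IsSingularKernel Ω S K)
    (hK : Integrable (Function.uncurry K)
      (((volume : Measure (EuclideanSpace ℝ (Fin n))).restrict U).prod (volume.restrict V)))
    {φ : EuclideanSpace ℝ (Fin n) → ℂ} (hφ : Continuous φ) (hφc : HasCompactSupport φ)
    (hφV : tsupport φ ⊆ V) {u : L2 Ω} (hu : u =ᵐ[lebesgueOn Ω] φ) :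
    S u =ᵐ[volume.restrict U] fun x => ∫ y in V, K x y * φ y := by
  obtain ⟨M, hM⟩ := hφ.bounded_above_of_compact_support hφc
  have hint : Integrable (fun z : EuclideanSpace ℝ (Fin n) × EuclideanSpace ℝ (Fin n) =>
      K z.1 z.2 * φ z.2)
      (((volume : Measure (EuclideanSpace ℝ (Fin n))).restrict U).prod (volume.restrict V)) :=
    hK.mul_bdd (c := M) (hφ.comp continuous_snd).aestronglyMeasurable
      (ae_of_all _ fun z => hM z.2)
  refine hU.ae_eq_of_integral_contDiff_smul_eq
    ((L2.memLp_restrict hUΩ (S u)).locallyIntegrable (by norm_num))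
    -- A test function `χ` supported in `U` has support disjoint from that of `φ`, so the kernel
    -- identity applies to the pair.
    hint.integral_prod_left.locallyIntegrable fun χ hχ hχc hχU => ?_
  have hχ0 : ∀ x, x ∉ U → χ x = 0 := fun x hx =>
    image_eq_zero_of_notMem_tsupport fun h => hx (hχU h)
  have hφ0 : ∀ x, x ∉ V → φ x = 0 := fun x hx =>
    image_eq_zero_of_notMem_tsupport fun h => hx (hφV h)
  have hts : tsupport (fun x => (χ x : ℂ)) ⊆ tsupport χ :=
    closure_mono fun x hx h => hx (by simp [h])
  have key := (hS.2 φ (fun x => (χ x : ℂ)) hφ hφc (hφV.trans hVΩ)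
    (Complex.continuous_ofReal.comp hχ) (hχc.comp_left (g := Complex.ofReal) rfl)
    (hts.trans (hχU.trans hUΩ))
    (hUV.symm.mono hφV (hts.trans hχU))).2 u hu
  simp only [Complex.conj_ofReal] at key
  rw [setIntegral_eq_of_subset_of_forall_sdiff_eq_zero hΩ.measurableSet hUΩ
    (fun x hx => by simp [hχ0 x hx.2]),
    setIntegral_eq_of_subset_of_forall_sdiff_eq_zero hΩ.measurableSet hUΩ
    (fun x hx => by simp [hχ0 x hx.2])] at key
  rw [setIntegral_congr_fun hU.measurableSet (fun x _ => mul_comm (χ x : ℂ) (S u x)), key]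
  refine setIntegral_congr_fun hU.measurableSet fun x _ => ?_
  rw [setIntegral_eq_of_subset_of_forall_sdiff_eq_zero hΩ.measurableSet hVΩ
    (fun y hy => by simp [hφ0 y hy.2]), integral_mul_const, mul_comm]

/-- For bounded `g` supported in `U`, the function `S† g` is given by the adjoint kernel on `V`. -/
theorem IsSingularKernel.adjoint_ae_eq_integral (hΩ : IsOpen Ω) (hU : IsOpen U) (hUΩ : U ⊆ Ω)
    (hV : IsOpen V) (hVΩ : V ⊆ Ω) (hUV : Disjoint U V) (hS : IsSingularKernel Ω S K)
    (hK : Integrable (Function.uncurry K)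
      (((volume : Measure (EuclideanSpace ℝ (Fin n))).restrict U).prod (volume.restrict V)))
    {g : L2 Ω} {M : ℝ} (hgM : ∀ᵐ x ∂(lebesgueOn Ω), ‖g x‖ ≤ M)
    (hgU : ∀ᵐ x ∂(lebesgueOn Ω), x ∉ U → g x = 0) :
    ContinuousLinearMap.adjoint S g =ᵐ[volume.restrict V]
      fun x => ∫ z in U, conj (K z x) * g z := by
  have hac : (volume.restrict U : Measure (EuclideanSpace ℝ (Fin n))) ≤ lebesgueOn Ω :=
    Measure.restrict_mono_set _ hUΩ
  have hgM' : ∀ᵐ x ∂(volume.restrict U), ‖g x‖ ≤ M := ae_mono hac hgM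
  have hgm : AEStronglyMeasurable g (volume.restrict U) := (L2.memLp_restrict hUΩ g).1
  have hint : Integrable (fun z : EuclideanSpace ℝ (Fin n) × EuclideanSpace ℝ (Fin n) =>
      K z.1 z.2 * conj (g z.1))
      (((volume : Measure (EuclideanSpace ℝ (Fin n))).restrict U).prod (volume.restrict V)) := by
    refine hK.mul_bdd (c := M) ?_ ?_
    · exact (Complex.continuous_conj.comp_aestronglyMeasurable hgm).comp_fst
    · refine Measure.quasiMeasurePreserving_fst.ae (p := fun x => ‖conj (g x)‖ ≤ M) ?_
      simpa only [RCLike.norm_conj] using hgM'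
  have hmain : (fun x => conj (ContinuousLinearMap.adjoint S g x)) =ᵐ[volume.restrict V]
      fun y => ∫ x in U, K x y * conj (g x) := by
    refine hV.ae_eq_of_integral_contDiff_smul_eq ?_ hint.integral_prod_right.locallyIntegrable
      fun χ hχ hχc hχV => ?_
    · refine MemLp.locallyIntegrable (p := 2) ?_ (by norm_num)
      exact (L2.memLp_restrict hVΩ _).star
    have hχ0 : ∀ x, x ∉ V → χ x = 0 := fun x hx =>
      image_eq_zero_of_notMem_tsupport fun h => hx (hχV h)
    have hts : tsupport (fun x => (χ x : ℂ)) ⊆ tsupport χ :=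
      closure_mono fun x hx h => hx (by simp [h])
    have hχC : Continuous fun x => (χ x : ℂ) := Complex.continuous_ofReal.comp hχ
    have hχcC : HasCompactSupport fun x => (χ x : ℂ) := hχc.comp_left (g := Complex.ofReal) rfl
    have hmem : MemLp (fun x => (χ x : ℂ)) 2 (lebesgueOn Ω) := hχC.memLp_of_hasCompactSupport hχcC
    have hu := hmem.coeFn_toLp
    have hSu := hS.ae_eq_integral hΩ hU hUΩ hVΩ hUV hK hχC hχcC (hts.trans hχV) hu
    -- Duality moves `S` onto the continuous test function, where the kernel formula is available;
    -- hence `g` need only be bounded.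
    have hadj := ContinuousLinearMap.adjoint_inner_left S (hmem.toLp _) g
    rw [L2.inner_def, L2.inner_def] at hadj
    simp only [RCLike.inner_apply] at hadj
    have h1 : ∫ x in Ω, hmem.toLp _ x * conj (ContinuousLinearMap.adjoint S g x) =
        ∫ x in V, (χ x : ℂ) * conj (ContinuousLinearMap.adjoint S g x) := by
      rw [← setIntegral_eq_of_subset_of_forall_sdiff_eq_zero hΩ.measurableSet hVΩ
        (f := fun x => (χ x : ℂ) * conj (ContinuousLinearMap.adjoint S g x))
        (fun x hx => by simp [hχ0 x hx.2])]
      refine integral_congr_ae ?_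
      filter_upwards [hu] with x hx
      rw [hx]
    have h2 : ∫ x in Ω, S (hmem.toLp _) x * conj (g x) =
        ∫ x in U, ∫ y in V, K x y * conj (g x) * (χ y : ℂ) := by
      rw [setIntegral_eq_of_subset_of_ae_sdiff_eq_zero hΩ.measurableSet.nullMeasurableSet hUΩ]
      · refine integral_congr_ae ?_
        filter_upwards [hSu] with x hx
        rw [hx, ← integral_mul_const]
        refine integral_congr_ae (ae_of_all _ fun y => ?_)
        ring
      · filter_upwards [(ae_restrict_iff' hΩ.measurableSet).1 hgU] with x hx hxd
        simp [hx hxd.1 hxd.2]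
    rw [h1, h2] at hadj
    rw [hadj]
    obtain ⟨B, hB⟩ := hχC.bounded_above_of_compact_support hχcC
    -- Fubini is legitimate because `K` is integrable on `U × V` and both other factors are bounded.
    rw [integral_integral_swap]
    · refine integral_congr_ae (ae_of_all _ fun y => ?_)
      simp only
      rw [integral_mul_const, mul_comm]
    · exact hint.mul_bdd (c := B) (hχC.comp continuous_snd).aestronglyMeasurable
        (ae_of_all _ fun z => hB z.2)
  filter_upwards [hmain] with x hx
  have h := congrArg conj hx
  rw [Complex.conj_conj] at h
  rw [h, ← integral_conj]
  simp

end SingularKernel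

end

noncomputable section

/-! ### Mean oscillation bounds and extension to bounded functions -/

section MeanBound

variable {n : ℕ} {Ω : Set (EuclideanSpace ℝ (Fin n))}
  {K : EuclideanSpace ℝ (Fin n) → EuclideanSpace ℝ (Fin n) → ℂ} {S : L2 Ω →L[ℂ] L2 Ω}
  {r : ℝ} {C : ℝ≥0∞}

/-- `S` has the singular kernel `K`, whose columns have mass at most `C` outside the balls of
radius `r`. -/
structure HasOffDiagonalKernel (Ω : Set (EuclideanSpace ℝ (Fin n))) (S : L2 Ω →L[ℂ] L2 Ω)
    (K : EuclideanSpace ℝ (Fin n) → EuclideanSpace ℝ (Fin n) → ℂ) (r : ℝ) (C : ℝ≥0∞) : Prop where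
  isOpen : IsOpen Ω
  isSingularKernel : IsSingularKernel Ω S K
  radius_pos : 0 < r
  const_ne_top : C ≠ ⊤
  lintegral_le : ∀ y ∈ Ω, ∫⁻ x in Ω \ ballIn Ω y r, ‖K x y‖ₑ ≤ C

theorem isOpen_ballIn (hΩ : IsOpen Ω) (y : EuclideanSpace ℝ (Fin n)) (R : ℝ) :
    IsOpen (ballIn Ω y R) := hΩ.inter Metric.isOpen_ball

theorem isOpen_sdiff_closedBall (hΩ : IsOpen Ω) (y : EuclideanSpace ℝ (Fin n)) (R : ℝ) :
    IsOpen (Ω \ Metric.closedBall y R) := hΩ.sdiff Metric.isClosed_closedBall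

theorem volume_ballIn_lt_top (y : EuclideanSpace ℝ (Fin n)) (R : ℝ) :
    volume (ballIn Ω y R) < ⊤ :=
  (measure_mono inter_subset_right).trans_lt measure_ball_lt_top

theorem disjoint_far_ballIn {y : EuclideanSpace ℝ (Fin n)} {R ρ : ℝ} (h : R ≤ ρ) :
    Disjoint (Ω \ Metric.closedBall y ρ) (ballIn Ω y R) :=
  disjoint_left.2 fun _ hx hx' =>
    hx.2 (Metric.closedBall_subset_closedBall h (Metric.ball_subset_closedBall hx'.2))

/-- By the triangle inequality, enlarging the radius by `r` leaves the far set outside `B(z, r)` for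
every `z` in the ball. -/
theorem HasOffDiagonalKernel.lintegral_far_le (h : HasOffDiagonalKernel Ω S K r C)
    {y z : EuclideanSpace ℝ (Fin n)} {R : ℝ} (hz : z ∈ ballIn Ω y R) :
    ∫⁻ x in Ω \ Metric.closedBall y (R + r), ‖K x z‖ₑ ≤ C := by
  refine (lintegral_mono_set (t := Ω \ ballIn Ω z r)
    fun x hx => ⟨hx.1, fun hx' => hx.2 ?_⟩).trans (h.lintegral_le z hz.1)
  have h1 : dist x z < r := hx'.2
  have h2 : dist z y < R := hz.2
  rw [Metric.mem_closedBall]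
  linarith [dist_triangle x z y]

theorem HasOffDiagonalKernel.aestronglyMeasurable (h : HasOffDiagonalKernel Ω S K r C)
    (y : EuclideanSpace ℝ (Fin n)) (R : ℝ) :
    AEStronglyMeasurable (Function.uncurry K)
      ((volume.restrict (Ω \ Metric.closedBall y (R + r))).prod (volume.restrict (ballIn Ω y R))) :=
  aestronglyMeasurable_kernel_restrict sdiff_subset inter_subset_left h.isSingularKernel.1

theorem HasOffDiagonalKernel.lintegral_prod_le (h : HasOffDiagonalKernel Ω S K r C)
    (y : EuclideanSpace ℝ (Fin n)) (R : ℝ) :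
    ∫⁻ z, ‖Function.uncurry K z‖ₑ
      ∂(volume.restrict (Ω \ Metric.closedBall y (R + r))).prod (volume.restrict (ballIn Ω y R)) ≤
      C * volume (ballIn Ω y R) :=
  lintegral_kernel_le (isOpen_ballIn h.isOpen y R).measurableSet (h.aestronglyMeasurable y R)
    fun _ hz => h.lintegral_far_le hz

theorem HasOffDiagonalKernel.integrable (h : HasOffDiagonalKernel Ω S K r C)
    (y : EuclideanSpace ℝ (Fin n)) (R : ℝ) :
    Integrable (Function.uncurry K)
      ((volume.restrict (Ω \ Metric.closedBall y (R + r))).prod (volume.restrict (ballIn Ω y R))) :=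
  ⟨h.aestronglyMeasurable y R, (h.lintegral_prod_le y R).trans_lt
    (ENNReal.mul_lt_top h.const_ne_top.lt_top (volume_ballIn_lt_top y R))⟩

theorem memLp_indicator_closedBall {f : EuclideanSpace ℝ (Fin n) → ℂ}
    (hf : MemLp f ⊤ (lebesgueOn Ω)) (y : EuclideanSpace ℝ (Fin n)) (ρ : ℝ) :
    MemLp ((Metric.closedBall y ρ).indicator f) 2 (lebesgueOn Ω) := by
  rw [memLp_indicator_iff_restrict Metric.isClosed_closedBall.measurableSet]
  have : IsFiniteMeasure ((lebesgueOn Ω).restrict (Metric.closedBall y ρ)) :=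
    ⟨by
      rw [Measure.restrict_apply_univ]
      exact (Measure.restrict_apply_le _ _).trans_lt measure_closedBall_lt_top⟩
  exact (hf.restrict _).mono_exponent le_top

/-- The truncation of a bounded function to a ball, as an element of `L²(Ω)`. -/
def truncation {f : EuclideanSpace ℝ (Fin n) → ℂ} (hf : MemLp f ⊤ (lebesgueOn Ω))
    (y : EuclideanSpace ℝ (Fin n)) (ρ : ℝ) : L2 Ω :=
  (memLp_indicator_closedBall hf y ρ).toLp _

theorem coeFn_truncation {f : EuclideanSpace ℝ (Fin n) → ℂ} (hf : MemLp f ⊤ (lebesgueOn Ω))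
    (y : EuclideanSpace ℝ (Fin n)) (ρ : ℝ) :
    truncation hf y ρ =ᵐ[lebesgueOn Ω] (Metric.closedBall y ρ).indicator f :=
  MemLp.coeFn_toLp _

theorem enorm_truncation_le {f : EuclideanSpace ℝ (Fin n) → ℂ} (hf : MemLp f ⊤ (lebesgueOn Ω))
    (y : EuclideanSpace ℝ (Fin n)) {ρ : ℝ} (hρ : ρ ≠ 0) :
    ‖truncation hf y ρ‖ₑ ≤
      eLpNorm f ⊤ (lebesgueOn Ω) * volume (ballIn Ω y ρ) ^ (1 / 2 : ℝ) := by
  have hvol : (lebesgueOn Ω) (Metric.closedBall y ρ) ≤ volume (ballIn Ω y ρ) := by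
    -- Truncation uses closed balls so that the far set is open, while doubling concerns open balls.
    -- The sphere between them is null since `ρ ≠ 0`.
    rw [Measure.restrict_apply Metric.isClosed_closedBall.measurableSet, ← Metric.ball_union_sphere,
      union_inter_distrib_right]
    refine (measure_union_le _ _).trans ?_
    rw [measure_mono_null (inter_subset_left (s := Metric.sphere y ρ))
      (Measure.addHaar_sphere_of_ne_zero _ y hρ), add_zero, inter_comm]
    rfl
  rw [Lp.enorm_def, eLpNorm_congr_ae (coeFn_truncation hf y ρ),
    eLpNorm_indicator_eq_eLpNorm_restrict Metric.isClosed_closedBall.measurableSet]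
  refine (eLpNorm_le_eLpNorm_mul_rpow_measure_univ (q := ⊤) le_top
    (hf.1.mono_measure Measure.restrict_le_self)).trans ?_
  rw [Measure.restrict_apply_univ]
  gcongr
  · exact Measure.restrict_le_self
  · simpa using ENNReal.rpow_le_rpow hvol (by norm_num)

theorem L2.lintegral_enorm_le {V : Set (EuclideanSpace ℝ (Fin n))} (hVΩ : V ⊆ Ω) (w : L2 Ω) :
    ∫⁻ x in V, ‖w x‖ₑ ≤ ‖w‖ₑ * volume V ^ (1 / 2 : ℝ) := by
  have h := eLpNorm_le_eLpNorm_mul_rpow_measure_univ (p := 1) (q := 2) (by norm_num)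
    (L2.memLp_restrict hVΩ w).1
  rw [eLpNorm_one_eq_lintegral_enorm, Measure.restrict_apply_univ] at h
  have he : (1 / (1 : ℝ≥0∞).toReal - 1 / (2 : ℝ≥0∞).toReal : ℝ) = 1 / 2 := by norm_num
  rw [he] at h
  refine h.trans ?_
  rw [Lp.enorm_def]
  gcongr
  exact Measure.restrict_mono_set _ hVΩ

theorem norm_le_of_memLp_top {f : EuclideanSpace ℝ (Fin n) → ℂ} (hf : MemLp f ⊤ (lebesgueOn Ω)) :
    ∀ᵐ x ∂(lebesgueOn Ω), ‖f x‖ ≤ (eLpNorm f ⊤ (lebesgueOn Ω)).toReal := by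
  filter_upwards [enorm_ae_le_eLpNormEssSup f (lebesgueOn Ω)] with x hx
  rw [← eLpNorm_exponent_top] at hx
  rw [← toReal_enorm]
  exact ENNReal.toReal_mono hf.2.ne hx

/-- Near-far decomposition of `S† u` on a ball. -/
theorem HasOffDiagonalKernel.adjoint_ae_eq (h : HasOffDiagonalKernel Ω S K r C) {u : L2 Ω}
    (hu : MemLp u ⊤ (lebesgueOn Ω)) (y : EuclideanSpace ℝ (Fin n)) (R : ℝ) :
    ContinuousLinearMap.adjoint S u =ᵐ[volume.restrict (ballIn Ω y R)] fun x =>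
      ContinuousLinearMap.adjoint S (truncation hu y (R + r)) x +
        ∫ z in Ω \ Metric.closedBall y (R + r), conj (K z x) * u z := by
  set t := truncation hu y (R + r) with ht
  have hw : ((u - t : L2 Ω) : EuclideanSpace ℝ (Fin n) → ℂ) =ᵐ[lebesgueOn Ω]
      fun x => u x - (Metric.closedBall y (R + r)).indicator u x := by
    filter_upwards [Lp.coeFn_sub u t, coeFn_truncation hu y (R + r)] with x h1 h2
    rw [h1, Pi.sub_apply, ht, h2]
  have hwM : ∀ᵐ x ∂(lebesgueOn Ω), ‖(u - t : L2 Ω) x‖ ≤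
      (eLpNorm u ⊤ (lebesgueOn Ω)).toReal := by
    filter_upwards [hw, norm_le_of_memLp_top hu] with x h1 h2
    rw [h1]
    by_cases hx : x ∈ Metric.closedBall y (R + r)
    · simp [indicator_of_mem hx]
    · simpa [indicator_of_notMem hx] using h2
  have hwU : ∀ᵐ x ∂(lebesgueOn Ω), x ∉ Ω \ Metric.closedBall y (R + r) → (u - t : L2 Ω) x = 0 := by
    filter_upwards [hw, ae_restrict_mem h.isOpen.measurableSet] with x h1 hxΩ hx
    have hx' : x ∈ Metric.closedBall y (R + r) := by
      by_contra hcon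
      exact hx ⟨hxΩ, hcon⟩
    rw [h1, indicator_of_mem hx', sub_self]
  have hfar := h.isSingularKernel.adjoint_ae_eq_integral h.isOpen
    (isOpen_sdiff_closedBall h.isOpen y (R + r)) sdiff_subset (isOpen_ballIn h.isOpen y R)
    inter_subset_left (disjoint_far_ballIn (by linarith [h.radius_pos])) (h.integrable y R) hwM hwU
  have hadd : ContinuousLinearMap.adjoint S u =
      ContinuousLinearMap.adjoint S t + ContinuousLinearMap.adjoint S (u - t) := by
    rw [← map_add, add_sub_cancel]
  have hsum := ae_mono (Measure.restrict_mono_set volume (inter_subset_left (s := Ω)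
    (t := Metric.ball y R))) (Lp.coeFn_add (ContinuousLinearMap.adjoint S t)
      (ContinuousLinearMap.adjoint S (u - t)))
  rw [← hadd] at hsum
  filter_upwards [hfar, hsum] with x h1 h2
  rw [h2, Pi.add_apply, h1]
  congr 1
  refine integral_congr_ae ?_
  filter_upwards [ae_mono (Measure.restrict_mono_set volume (sdiff_subset (s := Ω)
    (t := Metric.closedBall y (R + r)))) hw,
    ae_restrict_mem (isOpen_sdiff_closedBall h.isOpen y (R + r)).measurableSet] with z hz hzU
  rw [hz, indicator_of_notMem hzU.2, sub_zero]

/-- Tonelli. The weight `|q|` stays inside the integral so that the same estimate serves a uniform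
bound (`q = u`) and dominated convergence (`q = u k - f`). -/
theorem HasOffDiagonalKernel.lintegral_enorm_integral_le (h : HasOffDiagonalKernel Ω S K r C)
    {q : EuclideanSpace ℝ (Fin n) → ℂ} (hq : AEStronglyMeasurable q (lebesgueOn Ω))
    (y : EuclideanSpace ℝ (Fin n)) (R : ℝ) :
    ∫⁻ x in ballIn Ω y R, ‖∫ z in Ω \ Metric.closedBall y (R + r), conj (K z x) * q z‖ₑ ≤
      ∫⁻ z, ‖Function.uncurry K z‖ₑ * ‖q z.1‖ₑ
        ∂(volume.restrict (Ω \ Metric.closedBall y (R + r))).prod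
          (volume.restrict (ballIn Ω y R)) := by
  have hm : AEMeasurable (fun z : EuclideanSpace ℝ (Fin n) × EuclideanSpace ℝ (Fin n) =>
      ‖Function.uncurry K z‖ₑ * ‖q z.1‖ₑ)
      ((volume.restrict (Ω \ Metric.closedBall y (R + r))).prod
        (volume.restrict (ballIn Ω y R))) :=
    (h.aestronglyMeasurable y R).enorm.mul
      (hq.mono_measure (Measure.restrict_mono_set _ sdiff_subset)).comp_fst.enorm
  rw [lintegral_prod_symm _ hm]
  refine lintegral_mono fun x => (enorm_integral_le_lintegral_enorm _).trans_eq ?_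
  refine lintegral_congr fun z => ?_
  rw [enorm_mul, RCLike.enorm_conj]
  rfl

theorem IsDoubling.volume_rpow_le {D : ℝ} (hD : IsDoubling Ω D) {y : EuclideanSpace ℝ (Fin n)}
    (hy : y ∈ Ω) (hr : 0 < r) :
    volume (ballIn Ω y (r + r)) ^ (1 / 2 : ℝ) ≤
      ENNReal.ofReal (Real.sqrt D) * volume (ballIn Ω y r) ^ (1 / 2 : ℝ) := by
  have h := hD y hy r hr
  rw [two_mul] at h
  have hs : ENNReal.ofReal D ^ (1 / 2 : ℝ) = ENNReal.ofReal (Real.sqrt D) := by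
    -- For negative `D` both sides are 0, by the conventions for `ENNReal.ofReal` and `Real.sqrt`.
    rcases le_or_gt 0 D with h0 | h0
    · rw [ENNReal.ofReal_rpow_of_nonneg h0 (by norm_num), Real.sqrt_eq_rpow]
    · rw [ENNReal.ofReal_of_nonpos h0.le, Real.sqrt_eq_zero_of_nonpos h0.le]
      simp
  rw [← hs, ← ENNReal.mul_rpow_of_nonneg _ _ (by norm_num)]
  gcongr

/-- The mean value bound for `S† u` with bounded `u ∈ L²(Ω)`. -/
theorem HasOffDiagonalKernel.lintegral_adjoint_le (h : HasOffDiagonalKernel Ω S K r C) {D : ℝ}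
    (hD : IsDoubling Ω D) {A : ℝ≥0∞} (hA : ‖S‖ₑ ≤ A) {u : L2 Ω} (hu : MemLp u ⊤ (lebesgueOn Ω))
    {y : EuclideanSpace ℝ (Fin n)} (hy : y ∈ Ω) :
    ∫⁻ x in ballIn Ω y r, ‖ContinuousLinearMap.adjoint S u x‖ₑ ≤
      (A * ENNReal.ofReal (Real.sqrt D) + C) * eLpNorm u ⊤ (lebesgueOn Ω) *
        volume (ballIn Ω y r) := by
  have hr := h.radius_pos
  set m := eLpNorm u ⊤ (lebesgueOn Ω)
  set v := volume (ballIn Ω y r)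
  have hv : v ^ (1 / 2 : ℝ) * v ^ (1 / 2 : ℝ) = v := by
    rw [← ENNReal.rpow_add_of_nonneg _ _ (by norm_num) (by norm_num)]
    norm_num
  set T := ContinuousLinearMap.adjoint S (truncation hu y (r + r))
  -- Near part: the other factor `v ^ (1/2)` will come from Cauchy–Schwarz on the ball.
  have hTnorm : ‖T‖ₑ ≤ A * (m * (ENNReal.ofReal (Real.sqrt D) * v ^ (1 / 2 : ℝ))) := by
    calc ‖T‖ₑ ≤ ‖ContinuousLinearMap.adjoint S‖ₑ * ‖truncation hu y (r + r)‖ₑ :=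
          ContinuousLinearMap.le_opENorm _ _
      _ ≤ A * (m * volume (ballIn Ω y (r + r)) ^ (1 / 2 : ℝ)) := by
          gcongr
          · rwa [← ofReal_norm, LinearIsometryEquiv.norm_map, ofReal_norm]
          · exact enorm_truncation_le hu y (by linarith)
      _ ≤ _ := by
          gcongr
          exact hD.volume_rpow_le hy hr
  have hfar : ∫⁻ x in ballIn Ω y r,
      ‖∫ z in Ω \ Metric.closedBall y (r + r), conj (K z x) * u z‖ₑ ≤ C * v * m := by
    refine (h.lintegral_enorm_integral_le (Lp.aestronglyMeasurable u) y r).trans ?_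
    calc _ ≤ ∫⁻ z, ‖Function.uncurry K z‖ₑ * m
            ∂(volume.restrict (Ω \ Metric.closedBall y (r + r))).prod
              (volume.restrict (ballIn Ω y r)) := by
          refine lintegral_mono_ae ?_
          have hm : ∀ᵐ x ∂(volume.restrict (Ω \ Metric.closedBall y (r + r))), ‖u x‖ₑ ≤ m := by
            have := enorm_ae_le_eLpNormEssSup u (lebesgueOn Ω)
            rw [← eLpNorm_exponent_top] at this
            exact ae_mono (Measure.restrict_mono_set _ sdiff_subset) this
          filter_upwards [Measure.quasiMeasurePreserving_fst.ae hm] with z hz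
          gcongr
      _ ≤ _ := by
          rw [lintegral_mul_const'' _ (h.aestronglyMeasurable y r).enorm]
          gcongr
          exact h.lintegral_prod_le y r
  calc _ ≤ ∫⁻ x in ballIn Ω y r, (‖T x‖ₑ +
        ‖∫ z in Ω \ Metric.closedBall y (r + r), conj (K z x) * u z‖ₑ) := by
        refine lintegral_mono_ae ?_
        filter_upwards [h.adjoint_ae_eq hu y r] with x hx
        rw [hx]
        exact enorm_add_le _ _
    _ = (∫⁻ x in ballIn Ω y r, ‖T x‖ₑ) + ∫⁻ x in ballIn Ω y r,
        ‖∫ z in Ω \ Metric.closedBall y (r + r), conj (K z x) * u z‖ₑ :=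
        lintegral_add_left' (L2.memLp_restrict inter_subset_left T).1.enorm _
    _ ≤ A * (m * (ENNReal.ofReal (Real.sqrt D) * v ^ (1 / 2 : ℝ))) * v ^ (1 / 2 : ℝ) +
        C * v * m := by
        gcongr
        exact (L2.lintegral_enorm_le inter_subset_left T).trans (mul_le_mul_left hTnorm _)
    _ = A * ENNReal.ofReal (Real.sqrt D) * m * (v ^ (1 / 2 : ℝ) * v ^ (1 / 2 : ℝ)) +
        C * v * m := by ring
    _ = _ := by rw [hv]; ring

end MeanBound

end

noncomputable section

/-! ### Extension of the adjoint to bounded functions -/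

section Extension

variable {n : ℕ} {Ω : Set (EuclideanSpace ℝ (Fin n))}
  {K : EuclideanSpace ℝ (Fin n) → EuclideanSpace ℝ (Fin n) → ℂ} {S : L2 Ω →L[ℂ] L2 Ω}
  {r : ℝ} {C : ℝ≥0∞} {f : EuclideanSpace ℝ (Fin n) → ℂ}

theorem norm_truncation_ae_le (hf : MemLp f ⊤ (lebesgueOn Ω)) (k : ℕ) :
    ∀ᵐ x ∂(lebesgueOn Ω), ‖truncation hf 0 k x‖ ≤ (eLpNorm f ⊤ (lebesgueOn Ω)).toReal := by
  filter_upwards [coeFn_truncation hf 0 k, norm_le_of_memLp_top hf] with x h1 h2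
  rw [h1]
  exact (norm_indicator_le_norm_self _ _).trans h2

theorem tendsto_truncation (hf : MemLp f ⊤ (lebesgueOn Ω)) :
    ∀ᵐ x ∂(lebesgueOn Ω), Tendsto (fun k : ℕ => truncation hf 0 k x) atTop (𝓝 (f x)) := by
  filter_upwards [ae_all_iff.2 fun k : ℕ => coeFn_truncation hf 0 k] with x hx
  refine tendsto_const_nhds.congr' ?_
  filter_upwards [eventually_ge_atTop ⌈‖x‖⌉₊] with k hk
  rw [hx k, indicator_of_mem]
  rw [mem_closedBall_zero_iff]
  exact (Nat.le_ceil _).trans (by exact_mod_cast hk)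

theorem eLpNorm_truncation_le (hf : MemLp f ⊤ (lebesgueOn Ω)) (k : ℕ) :
    eLpNorm (truncation hf 0 k) ⊤ (lebesgueOn Ω) ≤ eLpNorm f ⊤ (lebesgueOn Ω) := by
  rw [eLpNorm_congr_ae (coeFn_truncation hf 0 k)]
  exact eLpNorm_indicator_le _

theorem memLp_truncation (hf : MemLp f ⊤ (lebesgueOn Ω)) (k : ℕ) :
    MemLp (truncation hf 0 k) ⊤ (lebesgueOn Ω) :=
  ⟨Lp.aestronglyMeasurable _, (eLpNorm_truncation_le hf k).trans_lt hf.2⟩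

theorem ballIn_mono {y : EuclideanSpace ℝ (Fin n)} {R R' : ℝ} (h : R ≤ R') :
    ballIn Ω y R ⊆ ballIn Ω y R' := inter_subset_inter_right _ (Metric.ball_subset_ball h)

/-- Mean value bounds pass to the extension to bounded functions. -/
theorem IsBoundedExtensionValue.lintegral_le {T : L2 Ω →L[ℂ] L2 Ω} {A v : ℝ≥0∞}
    {y : EuclideanSpace ℝ (Fin n)}
    (hT : ∀ u : L2 Ω, MemLp u ⊤ (lebesgueOn Ω) →
      ∫⁻ x in ballIn Ω y r, ‖T u x‖ₑ ≤ A * eLpNorm u ⊤ (lebesgueOn Ω) * v)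
    (hf : MemLp f ⊤ (lebesgueOn Ω)) {h : EuclideanSpace ℝ (Fin n) → ℂ}
    (hh : IsBoundedExtensionValue Ω T f h) :
    ∫⁻ x in ballIn Ω y r, ‖h x‖ₑ ≤ A * eLpNorm f ⊤ (lebesgueOn Ω) * v := by
  have hlim := hh.2 (fun k => truncation hf 0 k) ⟨_, norm_truncation_ae_le hf⟩
    (tendsto_truncation hf) (‖y‖ + r)
  have hsub : ballIn Ω y r ⊆ ballIn Ω 0 (‖y‖ + r) := fun x hx => ⟨hx.1, by
    have h1 : dist x y < r := hx.2
    rw [mem_ball_zero_iff]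
    rw [dist_eq_norm] at h1
    linarith [norm_le_norm_add_norm_sub' x y]⟩
  have hlim' := hlim.const_add (A * eLpNorm f ⊤ (lebesgueOn Ω) * v)
  rw [add_zero] at hlim'
  -- The truncations of `f` obey the bound for `T` with the sup norm of `f`, and the `L¹` error on
  -- the larger ball tends to 0.
  refine ge_of_tendsto' hlim' fun k => ?_
  calc ∫⁻ x in ballIn Ω y r, ‖h x‖ₑ
      ≤ ∫⁻ x in ballIn Ω y r, (‖T (truncation hf 0 k) x‖ₑ +
          ‖T (truncation hf 0 k) x - h x‖ₑ) := by
        refine lintegral_mono fun x => ?_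
        have := enorm_sub_le (a := T (truncation hf 0 k) x) (b := T (truncation hf 0 k) x - h x)
        rwa [sub_sub_cancel] at this
    _ = (∫⁻ x in ballIn Ω y r, ‖T (truncation hf 0 k) x‖ₑ) +
        ∫⁻ x in ballIn Ω y r, ‖T (truncation hf 0 k) x - h x‖ₑ :=
        lintegral_add_left' (L2.memLp_restrict inter_subset_left _).1.enorm _
    _ ≤ _ := by
        refine add_le_add ((hT _ (memLp_truncation hf k)).trans ?_) (lintegral_mono_set hsub)
        gcongr
        exact eLpNorm_truncation_le hf k

/-- The extension of `S†` to the bounded function `f`, on the ball of radius `R`. -/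
def localExtension (S : L2 Ω →L[ℂ] L2 Ω)
    (K : EuclideanSpace ℝ (Fin n) → EuclideanSpace ℝ (Fin n) → ℂ) (r : ℝ)
    (hf : MemLp f ⊤ (lebesgueOn Ω)) (R : ℝ) (x : EuclideanSpace ℝ (Fin n)) : ℂ :=
  ContinuousLinearMap.adjoint S (truncation hf 0 (R + r)) x +
    ∫ z in Ω \ Metric.closedBall 0 (R + r), conj (K z x) * f z

theorem HasOffDiagonalKernel.integrable_mul (h : HasOffDiagonalKernel Ω S K r C)
    (hf : MemLp f ⊤ (lebesgueOn Ω)) (R : ℝ) :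
    Integrable (fun z : EuclideanSpace ℝ (Fin n) × EuclideanSpace ℝ (Fin n) =>
      conj (K z.1 z.2) * f z.1)
      ((volume.restrict (Ω \ Metric.closedBall 0 (R + r))).prod
        (volume.restrict (ballIn Ω 0 R))) := by
  have hle : (volume.restrict (Ω \ Metric.closedBall 0 (R + r)) :
      Measure (EuclideanSpace ℝ (Fin n))) ≤ lebesgueOn Ω :=
    Measure.restrict_mono_set _ sdiff_subset
  have hKc : Integrable (fun z : EuclideanSpace ℝ (Fin n) × EuclideanSpace ℝ (Fin n) =>
      conj (K z.1 z.2)) ((volume.restrict (Ω \ Metric.closedBall 0 (R + r))).prod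
        (volume.restrict (ballIn Ω 0 R))) :=
    (RCLike.conjCLE (K := ℂ)).toContinuousLinearMap.integrable_comp (h.integrable 0 R)
  exact hKc.mul_bdd (c := (eLpNorm f ⊤ (lebesgueOn Ω)).toReal)
    (hf.1.mono_measure hle).comp_fst
    (Measure.quasiMeasurePreserving_fst.ae (ae_mono hle (norm_le_of_memLp_top hf)))

theorem HasOffDiagonalKernel.aestronglyMeasurable_localExtension
    (h : HasOffDiagonalKernel Ω S K r C) (hf : MemLp f ⊤ (lebesgueOn Ω)) (R : ℝ) :
    AEStronglyMeasurable (localExtension S K r hf R) (volume.restrict (ballIn Ω 0 R)) :=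
  (L2.memLp_restrict inter_subset_left _).1.add
    (h.integrable_mul hf R).integral_prod_right.aestronglyMeasurable

theorem tendsto_enorm_truncation_sub (hf : MemLp f ⊤ (lebesgueOn Ω)) {u : ℕ → L2 Ω} {M : ℝ}
    (huM : ∀ k, ∀ᵐ x ∂(lebesgueOn Ω), ‖u k x - f x‖ₑ ≤ ENNReal.ofReal M)
    (hu : ∀ k, MemLp (u k) ⊤ (lebesgueOn Ω))
    (hlim : ∀ᵐ x ∂(lebesgueOn Ω), Tendsto (fun k => u k x) atTop (𝓝 (f x))) (ρ : ℝ) :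
    Tendsto (fun k => ‖truncation (hu k) 0 ρ - truncation hf 0 ρ‖ₑ) atTop (𝓝 0) := by
  set P : Set (EuclideanSpace ℝ (Fin n)) := Metric.closedBall 0 ρ
  have hP : MeasurableSet P := Metric.isClosed_closedBall.measurableSet
  have heq : ∀ k, ‖truncation (hu k) 0 ρ - truncation hf 0 ρ‖ₑ =
      (∫⁻ x in P, ‖u k x - f x‖ₑ ^ (2 : ℝ) ∂(lebesgueOn Ω)) ^ (1 / 2 : ℝ) := by
    intro k
    have h1 : ((truncation (hu k) 0 ρ - truncation hf 0 ρ : L2 Ω) :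
        EuclideanSpace ℝ (Fin n) → ℂ) =ᵐ[lebesgueOn Ω] P.indicator fun x => u k x - f x := by
      filter_upwards [Lp.coeFn_sub (truncation (hu k) 0 ρ) (truncation hf 0 ρ),
        coeFn_truncation (hu k) 0 ρ, coeFn_truncation hf 0 ρ] with x h1 h2 h3
      rw [h1, Pi.sub_apply, h2, h3]
      exact (congrFun (indicator_sub P (u k) f) x).symm
    rw [Lp.enorm_def, eLpNorm_congr_ae h1, eLpNorm_indicator_eq_eLpNorm_restrict hP,
      eLpNorm_eq_lintegral_rpow_enorm_toReal (by norm_num) (by norm_num)]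
    norm_num
  have h0 : Tendsto (fun k => ∫⁻ x in P, ‖u k x - f x‖ₑ ^ (2 : ℝ) ∂(lebesgueOn Ω)) atTop
      (𝓝 (∫⁻ _ in P, 0 ∂(lebesgueOn Ω))) := by
    refine tendsto_lintegral_of_dominated_convergence' (fun _ => ENNReal.ofReal M ^ (2 : ℝ))
      (fun k => ?_) (fun k => ?_) ?_ ?_
    · exact (((hu k).1.sub hf.1).mono_measure Measure.restrict_le_self).enorm.pow_const _
    · filter_upwards [ae_mono Measure.restrict_le_self (huM k)] with x hx
      gcongr
    · rw [lintegral_const, Measure.restrict_apply_univ]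
      refine (ENNReal.mul_lt_top (by simp) ?_).ne
      exact (Measure.restrict_apply_le _ _).trans_lt measure_closedBall_lt_top
    · filter_upwards [ae_mono Measure.restrict_le_self hlim] with x hx
      have h1 := (hx.sub_const (f x)).enorm.ennrpow_const 2
      simpa using h1
  simp only [heq]
  have h1 := h0.ennrpow_const (1 / 2)
  simpa using h1

/-- Near the ball the truncations converge in `L²` and `S†` is continuous; away from it `|K| M'` is
an integrable majorant on the product. -/
theorem HasOffDiagonalKernel.tendsto_localExtension (h : HasOffDiagonalKernel Ω S K r C)
    (hf : MemLp f ⊤ (lebesgueOn Ω)) {u : ℕ → L2 Ω} {M : ℝ}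
    (huM : ∀ k, ∀ᵐ x ∂(lebesgueOn Ω), ‖u k x‖ ≤ M)
    (hlim : ∀ᵐ x ∂(lebesgueOn Ω), Tendsto (fun k => u k x) atTop (𝓝 (f x))) (R : ℝ) :
    Tendsto (fun k => ∫⁻ x in ballIn Ω 0 R,
      ‖ContinuousLinearMap.adjoint S (u k) x - localExtension S K r hf R x‖ₑ) atTop (𝓝 0) := by
  have hu : ∀ k, MemLp (u k) ⊤ (lebesgueOn Ω) := fun k =>
    memLp_top_of_bound (Lp.aestronglyMeasurable _) M (huM k)
  set M' := M + (eLpNorm f ⊤ (lebesgueOn Ω)).toReal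
  have hM' : ∀ k, ∀ᵐ x ∂(lebesgueOn Ω), ‖u k x - f x‖ₑ ≤ ENNReal.ofReal M' := fun k => by
    filter_upwards [huM k, norm_le_of_memLp_top hf] with x h1 h2
    rw [← ofReal_norm]
    exact ENNReal.ofReal_le_ofReal (norm_sub_le_of_le h1 h2)
  have hle : (volume.restrict (Ω \ Metric.closedBall 0 (R + r)) :
      Measure (EuclideanSpace ℝ (Fin n))) ≤ lebesgueOn Ω :=
    Measure.restrict_mono_set _ sdiff_subset
  set d : ℕ → L2 Ω := fun k => truncation (hu k) 0 (R + r) - truncation hf 0 (R + r) with hd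
  set κ := ((volume.restrict (Ω \ Metric.closedBall 0 (R + r)) :
    Measure (EuclideanSpace ℝ (Fin n))).prod (volume.restrict (ballIn Ω 0 R)))
  have hnear : Tendsto (fun k => ‖ContinuousLinearMap.adjoint S‖ₑ * ‖d k‖ₑ *
      volume (ballIn Ω 0 R) ^ (1 / 2 : ℝ)) atTop (𝓝 0) := by
    have h1 := tendsto_enorm_truncation_sub hf hM' hu hlim (R + r)
    have h2 := ENNReal.Tendsto.mul_const (b := volume (ballIn Ω 0 R) ^ (1 / 2 : ℝ))
      (ENNReal.Tendsto.const_mul (a := ‖ContinuousLinearMap.adjoint S‖ₑ) h1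
      (Or.inr enorm_ne_top)) (Or.inr (ENNReal.rpow_ne_top_of_nonneg (by norm_num)
        (volume_ballIn_lt_top _ _).ne))
    simpa using h2
  have hfar : Tendsto (fun k => ∫⁻ z, ‖Function.uncurry K z‖ₑ * ‖u k z.1 - f z.1‖ₑ ∂κ) atTop
      (𝓝 0) := by
    rw [← lintegral_zero (μ := κ)]
    refine tendsto_lintegral_of_dominated_convergence'
      (fun z => ‖Function.uncurry K z‖ₑ * ENNReal.ofReal M') (fun k => ?_) (fun k => ?_) ?_ ?_
    · exact (h.aestronglyMeasurable 0 R).enorm.mul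
        (((hu k).1.sub hf.1).mono_measure hle).comp_fst.enorm
    · filter_upwards [Measure.quasiMeasurePreserving_fst.ae (ae_mono hle (hM' k))] with z hz
      gcongr
    · rw [lintegral_mul_const'' _ (h.aestronglyMeasurable 0 R).enorm]
      exact (ENNReal.mul_lt_top (h.integrable 0 R).2 ENNReal.ofReal_lt_top).ne
    · filter_upwards [Measure.quasiMeasurePreserving_fst.ae (ae_mono hle hlim)] with z hz
      have h1 := ENNReal.Tendsto.const_mul (a := ‖Function.uncurry K z‖ₑ)
        (hz.sub_const (f z.1)).enorm (Or.inr enorm_ne_top)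
      simpa using h1
  have hsum := hnear.add hfar
  rw [add_zero] at hsum
  refine tendsto_of_tendsto_of_tendsto_of_le_of_le tendsto_const_nhds hsum (fun k => zero_le)
    fun k => ?_
  have hdecomp : ∀ᵐ x ∂(volume.restrict (ballIn Ω 0 R)),
      ContinuousLinearMap.adjoint S (u k) x - localExtension S K r hf R x =
        ContinuousLinearMap.adjoint S (d k) x +
          ∫ z in Ω \ Metric.closedBall 0 (R + r), conj (K z x) * (u k z - f z) := by
    have hsub := ae_mono (Measure.restrict_mono_set volume (inter_subset_left (s := Ω)
      (t := Metric.ball 0 R))) (Lp.coeFn_sub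
        (ContinuousLinearMap.adjoint S (truncation (hu k) 0 (R + r)))
        (ContinuousLinearMap.adjoint S (truncation hf 0 (R + r))))
    rw [← map_sub] at hsub
    filter_upwards [h.adjoint_ae_eq (hu k) 0 R, hsub, (h.integrable_mul (hu k) R).prod_left_ae,
      (h.integrable_mul hf R).prod_left_ae] with x h1 h2 h3 h4
    rw [hd]
    simp only
    rw [h1, h2]
    simp only [localExtension, mul_sub, Pi.sub_apply]
    rw [integral_sub h3 h4]
    ring
  calc _ = ∫⁻ x in ballIn Ω 0 R, ‖ContinuousLinearMap.adjoint S (d k) x +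
          ∫ z in Ω \ Metric.closedBall 0 (R + r), conj (K z x) * (u k z - f z)‖ₑ :=
        lintegral_congr_ae (hdecomp.mono fun x hx => congrArg _ hx)
    _ ≤ ∫⁻ x in ballIn Ω 0 R, (‖ContinuousLinearMap.adjoint S (d k) x‖ₑ +
          ‖∫ z in Ω \ Metric.closedBall 0 (R + r), conj (K z x) * (u k z - f z)‖ₑ) :=
        lintegral_mono fun x => enorm_add_le _ _
    _ = (∫⁻ x in ballIn Ω 0 R, ‖ContinuousLinearMap.adjoint S (d k) x‖ₑ) +
        ∫⁻ x in ballIn Ω 0 R,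
          ‖∫ z in Ω \ Metric.closedBall 0 (R + r), conj (K z x) * (u k z - f z)‖ₑ :=
        lintegral_add_left' (L2.memLp_restrict inter_subset_left _).1.enorm _
    _ ≤ _ := by
        refine add_le_add ((L2.lintegral_enorm_le inter_subset_left _).trans ?_)
          (h.lintegral_enorm_integral_le ((hu k).1.sub hf.1) 0 R)
        exact mul_le_mul_left (ContinuousLinearMap.le_opENorm _ _) _

/-- On the smaller ball both functions are `L¹` limits of the same sequence, the images of the
truncations of `f`. -/
theorem HasOffDiagonalKernel.localExtension_ae_eq (h : HasOffDiagonalKernel Ω S K r C)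
    (hf : MemLp f ⊤ (lebesgueOn Ω)) {R R' : ℝ} (hR : R ≤ R') :
    localExtension S K r hf R =ᵐ[volume.restrict (ballIn Ω 0 R)] localExtension S K r hf R' := by
  have hm := h.aestronglyMeasurable_localExtension hf R
  have hm' := (h.aestronglyMeasurable_localExtension hf R').mono_measure
    (Measure.restrict_mono_set _ (ballIn_mono hR))
  set s : ℕ → L2 Ω := fun k => ContinuousLinearMap.adjoint S (truncation hf 0 k)
  have hl := h.tendsto_localExtension hf (norm_truncation_ae_le hf) (tendsto_truncation hf) R
  have hl' := h.tendsto_localExtension hf (norm_truncation_ae_le hf) (tendsto_truncation hf) R'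
  have hsum := hl.add hl'
  rw [add_zero] at hsum
  have hzero : ∫⁻ x in ballIn Ω 0 R,
      ‖localExtension S K r hf R x - localExtension S K r hf R' x‖ₑ = 0 := by
    refine le_antisymm (ge_of_tendsto' hsum fun k => ?_) zero_le
    calc _ ≤ ∫⁻ x in ballIn Ω 0 R, (‖s k x - localExtension S K r hf R x‖ₑ +
          ‖s k x - localExtension S K r hf R' x‖ₑ) := by
          refine lintegral_mono fun x => ?_
          have h1 := enorm_sub_le (a := s k x - localExtension S K r hf R' x)
            (b := s k x - localExtension S K r hf R x)
          rw [sub_sub_sub_cancel_left] at h1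
          rwa [add_comm]
      _ = (∫⁻ x in ballIn Ω 0 R, ‖s k x - localExtension S K r hf R x‖ₑ) +
          ∫⁻ x in ballIn Ω 0 R, ‖s k x - localExtension S K r hf R' x‖ₑ :=
          lintegral_add_left' ((L2.memLp_restrict inter_subset_left _).1.sub hm).enorm _
      _ ≤ _ := add_le_add le_rfl (lintegral_mono_set (ballIn_mono hR))
  filter_upwards [(lintegral_eq_zero_iff' (hm.sub hm').enorm).1 hzero] with x hx
  exact sub_eq_zero.1 (enorm_eq_zero.1 hx)

/-- The operator `S†` extends to bounded functions. -/
theorem HasOffDiagonalKernel.exists_isBoundedExtensionValue (h : HasOffDiagonalKernel Ω S K r C)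
    (hf : MemLp f ⊤ (lebesgueOn Ω)) :
    ∃ g, IsBoundedExtensionValue Ω (ContinuousLinearMap.adjoint S) f g := by
  -- The least natural radius whose open ball contains `x`. Using integer radii leaves only
  -- countably many exceptional null sets when gluing.
  set g : EuclideanSpace ℝ (Fin n) → ℂ := fun x => localExtension S K r hf (⌊‖x‖⌋₊ + 1 : ℕ) x
  have hg : ∀ N : ℕ, g =ᵐ[volume.restrict (ballIn Ω 0 N)] localExtension S K r hf N := by
    intro N
    have hall : ∀ m : ℕ, m ≤ N → ∀ᵐ x ∂(volume.restrict Ω), x ∈ Metric.ball 0 (m : ℝ) →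
        localExtension S K r hf m x = localExtension S K r hf N x := by
      intro m hm
      have h1 := h.localExtension_ae_eq hf (show (m : ℝ) ≤ N by exact_mod_cast hm)
      unfold ballIn at h1
      rw [inter_comm, ← Measure.restrict_restrict Metric.isOpen_ball.measurableSet] at h1
      exact (ae_restrict_iff' Metric.isOpen_ball.measurableSet).1 h1
    have h2 := ae_mono (Measure.restrict_mono_set volume
      (inter_subset_left (s := Ω) (t := Metric.ball 0 N)))
      (ae_all_iff.2 fun m => ae_all_iff.2 fun hm => hall m hm)
    filter_upwards [h2, ae_restrict_mem (isOpen_ballIn h.isOpen 0 N).measurableSet] with x hx hxN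
    refine hx _ ?_ ?_
    · exact Nat.succ_le_of_lt ((Nat.floor_lt (norm_nonneg _)).2 (mem_ball_zero_iff.1 hxN.2))
    · rw [mem_ball_zero_iff]
      push_cast
      exact Nat.lt_floor_add_one _
  refine ⟨g, ?_, ?_⟩
  · have hcov : (⋃ N : ℕ, ballIn Ω 0 (N : ℝ)) = Ω := by
      unfold ballIn
      rw [← inter_iUnion, Metric.iUnion_ball_nat, inter_univ]
    have : AEStronglyMeasurable g (volume.restrict (⋃ N : ℕ, ballIn Ω 0 (N : ℝ))) :=
      aestronglyMeasurable_iUnion_iff.2 fun N =>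
        (h.aestronglyMeasurable_localExtension hf N).congr (hg N).symm
    rwa [hcov] at this
  · rintro u ⟨M, hM⟩ hlim R
    obtain ⟨N, hN⟩ := exists_nat_ge R
    refine tendsto_of_tendsto_of_tendsto_of_le_of_le tendsto_const_nhds
      (h.tendsto_localExtension hf hM hlim N) (fun k => zero_le) fun k => ?_
    refine (lintegral_mono_set (ballIn_mono hN)).trans_eq (lintegral_congr_ae ?_)
    filter_upwards [hg N] with x hx
    rw [hx]

end Extension

end

noncomputable section

/-! ### Complex conjugation and the functional calculus -/

/-! ### Uniqueness for Laplace transforms of finite measures -/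

section Laplace

open BoundedContinuousFunction

/-- The function `l ↦ exp (-t l)` on `[0, ∞)`. -/
def expDecay (t : ℝ≥0) : ℝ≥0 →ᵇ ℂ :=
  BoundedContinuousFunction.ofNormedAddCommGroup
    (fun l => Complex.exp (-((t : ℝ) * (l : ℝ) : ℝ))) (by fun_prop) 1 (norm_heatSymbol_le t.2)

theorem expDecay_apply (t l : ℝ≥0) :
    expDecay t l = Complex.exp (-((t : ℝ) * (l : ℝ) : ℝ)) := rfl

theorem star_expDecay (t : ℝ≥0) : star (expDecay t) = expDecay t := by
  ext l
  rw [BoundedContinuousFunction.star_apply, expDecay_apply, Complex.star_def, ← Complex.exp_conj,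
    map_neg, Complex.conj_ofReal]

/-- The submonoid of all `exp (-t l)`. -/
def expDecaySubmonoid : Submonoid (ℝ≥0 →ᵇ ℂ) where
  carrier := range expDecay
  one_mem' := ⟨0, by ext l; simp [expDecay_apply]⟩
  mul_mem' := by
    rintro _ _ ⟨s, rfl⟩ ⟨t, rfl⟩
    refine ⟨s + t, ?_⟩
    ext l
    rw [BoundedContinuousFunction.mul_apply, expDecay_apply, expDecay_apply, expDecay_apply,
      ← Complex.exp_add]
    congr 1
    push_cast
    ring

/-- Finite measures on `[0, ∞)` are determined by their Laplace transforms. -/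
theorem MeasureTheory.Measure.ext_of_laplace {P Q : Measure ℝ≥0} [IsFiniteMeasure P]
    [IsFiniteMeasure Q] (h : ∀ t : ℝ≥0, ∫ l, expDecay t l ∂P = ∫ l, expDecay t l ∂Q) : P = Q := by
  set s : Set (ℝ≥0 →ᵇ ℂ) := (expDecaySubmonoid : Set (ℝ≥0 →ᵇ ℂ))
  have hstar : star s = s := by
    ext g
    constructor
    · rintro ⟨t, ht⟩
      exact ⟨t, by rw [← star_star g, ← ht, star_expDecay]⟩
    · rintro ⟨t, rfl⟩
      exact ⟨t, (star_expDecay t).symm⟩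
  -- The exponentials form a self-adjoint monoid, so the star algebra they generate is just their
  -- linear span, and equality of integrals extends to it by linearity. The exponential with `t = 1`
  -- already separates points.
  refine ext_of_forall_mem_subalgebra_integral_eq_of_pseudoEMetric_complete_countable
    (𝕜 := ℂ) (A := StarAlgebra.adjoin ℂ s) ?_ ?_
  · intro x y hxy
    refine ⟨_, ⟨_, ⟨expDecay 1, StarAlgebra.subset_adjoin ℂ s ⟨1, rfl⟩, rfl⟩, rfl⟩, ?_⟩
    change expDecay 1 x ≠ expDecay 1 y
    rw [expDecay_apply, expDecay_apply]
    intro hexp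
    rw [← Complex.ofReal_neg, ← Complex.ofReal_neg, ← Complex.ofReal_exp, ← Complex.ofReal_exp,
      Complex.ofReal_inj] at hexp
    apply hxy
    have := Real.exp_injective hexp
    simpa using this
  · intro g hg
    have hg' : g ∈ Submodule.span ℂ s := by
      have h1 : g ∈ (StarAlgebra.adjoin ℂ s).toSubalgebra := hg
      rw [StarAlgebra.adjoin_toSubalgebra, hstar, union_self] at h1
      have h2 : g ∈ Subalgebra.toSubmodule (Algebra.adjoin ℂ s) := h1
      rwa [Algebra.adjoin_eq_span, Submonoid.closure_eq] at h2
    clear hg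
    induction hg' using Submodule.span_induction with
    | mem x hx =>
      obtain ⟨t, rfl⟩ := hx
      exact h t
    | zero => simp
    | add x y _ _ hx hy =>
      simp only [BoundedContinuousFunction.add_apply]
      rw [integral_add (x.integrable P) (y.integrable P),
        integral_add (x.integrable Q) (y.integrable Q), hx, hy]
    | smul a x _ hx =>
      simp only [BoundedContinuousFunction.smul_apply]
      rw [integral_smul, integral_smul, hx]

end Laplace

/-! ### Conjugation invariance when the heat kernel is real -/

section Conjugation

variable {n : ℕ} {Ω : Set (EuclideanSpace ℝ (Fin n))}

theorem L2.star_add (u v : L2 Ω) : star (u + v) = star u + star v := by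
  refine Lp.ext ?_
  filter_upwards [Lp.coeFn_star (u + v), Lp.coeFn_add u v, Lp.coeFn_add (star u) (star v),
    Lp.coeFn_star u, Lp.coeFn_star v] with x h1 h2 h3 h4 h5
  rw [h1, h3, Pi.star_apply, h2, Pi.add_apply, Pi.add_apply, h4, h5, StarAddMonoid.star_add]
  rfl

theorem L2.star_smul (c : ℂ) (u : L2 Ω) : star (c • u) = conj c • star u := by
  refine Lp.ext ?_
  filter_upwards [Lp.coeFn_star (c • u), Lp.coeFn_smul c u, Lp.coeFn_smul (conj c) (star u),
    Lp.coeFn_star u] with x h1 h2 h3 h4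
  rw [h1, h3, Pi.star_apply, h2, Pi.smul_apply, Pi.smul_apply, h4, StarModule.star_smul]
  rfl

theorem L2.inner_star_star (u v : L2 Ω) :
    inner ℂ (star u) (star v) = conj (inner ℂ u v : ℂ) := by
  rw [L2.inner_def, L2.inner_def, ← integral_conj]
  refine integral_congr_ae ?_
  filter_upwards [Lp.coeFn_star u, Lp.coeFn_star v] with x h1 h2
  rw [h1, h2]
  simp [RCLike.inner_apply]

theorem L2.norm_star (u : L2 Ω) : ‖star u‖ = ‖u‖ := by
  rw [Lp.norm_def, Lp.norm_def, eLpNorm_congr_ae (Lp.coeFn_star u), eLpNorm_star]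

/-- If the semigroup commutes with conjugation, then so do the spectral measures. -/
theorem SpectralFamily.scalarMeasure_star (E : SpectralFamily (L2 Ω))
    (hE : ∀ t : ℝ, 0 < t → ∀ u : L2 Ω,
      E.integral (fun l => Complex.exp (-(t * (l : ℝ) : ℝ))) (star u) =
        star (E.integral (fun l => Complex.exp (-(t * (l : ℝ) : ℝ))) u)) (u : L2 Ω) :
    E.scalarMeasure (star u) = E.scalarMeasure u := by
  refine Measure.ext_of_laplace fun t => ?_
  -- Commutation is given only for `t > 0`; at `t = 0` the claim is equality of the total masses,
  -- that is `‖star u‖ = ‖u‖`.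
  rcases eq_or_ne t 0 with rfl | ht
  · simp [expDecay_apply, E.scalarMeasure_real_univ, L2.norm_star]
  · have hi := E.isIntegral_integral (measurable_heatSymbol t) (norm_heatSymbol_le t.2)
    have h1 := hi (star u)
    rw [hE t (by positivity) u, L2.inner_star_star, hi u, ← integral_conj] at h1
    simp only [expDecay_apply]
    rw [← h1]
    refine integral_congr_ae (ae_of_all _ fun l => ?_)
    simp only
    rw [← Complex.exp_conj, map_neg, Complex.conj_ofReal]

/-- Conjugating an operator by an antilinear isometry conjugates its quadratic form, and the
spectral measure does not distinguish `u` from `star u`. -/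
theorem SpectralFamily.integral_star (E : SpectralFamily (L2 Ω))
    (hE : ∀ t : ℝ, 0 < t → ∀ u : L2 Ω,
      E.integral (fun l => Complex.exp (-(t * (l : ℝ) : ℝ))) (star u) =
        star (E.integral (fun l => Complex.exp (-(t * (l : ℝ) : ℝ))) u))
    {F : ℝ≥0 → ℂ} {C : ℝ} (hF : Measurable F) (hC : ∀ l, ‖F l‖ ≤ C) (u : L2 Ω) :
    star (E.integral F (star u)) = E.integral (fun l => conj (F l)) u := by
  -- Two antilinear maps compose with a linear one to a linear map, so polarization applies.
  let J : L2 Ω →ₗ[ℂ] L2 Ω :=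
    { toFun := fun u => star (E.integral F (star u))
      map_add' := fun u v => by rw [L2.star_add, map_add, L2.star_add]
      map_smul' := fun c u => by
        rw [L2.star_smul, map_smul, L2.star_smul, Complex.conj_conj, RingHom.id_apply] }
  have hJ : J = (E.integral fun l => conj (F l) : L2 Ω →L[ℂ] L2 Ω) := by
    rw [← ext_inner_map]
    intro v
    have hc := E.isIntegral_integral (F := fun l => conj (F l)) (C := C)
      (Complex.continuous_conj.measurable.comp hF) (fun l => by rw [RCLike.norm_conj]; exact hC l) v
    have h1 : inner ℂ v (J v) = conj (inner ℂ (star v) (E.integral F (star v)) : ℂ) := by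
      rw [← L2.inner_star_star, star_star]
      rfl
    rw [E.isIntegral_integral hF hC, E.scalarMeasure_star hE, ← integral_conj, ← hc] at h1
    have h2 := congrArg conj h1
    rw [inner_conj_symm, inner_conj_symm] at h2
    exact h2
  exact LinearMap.congr_fun hJ u

theorem IsHeatKernel.heatSemigroup_star {L : L2 Ω →ₗ.[ℂ] L2 Ω}
    {p : ℝ → EuclideanSpace ℝ (Fin n) → EuclideanSpace ℝ (Fin n) → ℂ} (hΩ : IsOpen Ω)
    (hp : IsHeatKernel Ω L p) (hreal : ∀ t : ℝ, 0 < t → ∀ x ∈ Ω, ∀ y ∈ Ω, (p t x y).im = 0)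
    {t : ℝ} (ht : 0 < t) (u : L2 Ω) :
    heatSemigroup L t (star u) = star (heatSemigroup L t u) := by
  refine Lp.ext ?_
  filter_upwards [(hp t ht).2 (star u), (hp t ht).2 u, Lp.coeFn_star (heatSemigroup L t u),
    ae_restrict_mem hΩ.measurableSet] with x h1 h2 h3 hx
  rw [h1, h3, Pi.star_apply, h2, Complex.star_def, ← integral_conj]
  refine integral_congr_ae ?_
  filter_upwards [Lp.coeFn_star u, ae_restrict_mem hΩ.measurableSet] with y hy hyΩ
  rw [hy, map_mul, Complex.conj_eq_iff_im.2 (hreal t ht x hx y hyΩ)]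
  rfl

theorem IsHeatKernel.multiplier_star {L : L2 Ω →ₗ.[ℂ] L2 Ω}
    {p : ℝ → EuclideanSpace ℝ (Fin n) → EuclideanSpace ℝ (Fin n) → ℂ} (hΩ : IsOpen Ω)
    (hp : IsHeatKernel Ω L p) (hreal : ∀ t : ℝ, 0 < t → ∀ x ∈ Ω, ∀ y ∈ Ω, (p t x y).im = 0)
    {F : ℝ≥0 → ℂ} {C : ℝ} (hF : Measurable F) (hC : ∀ l, ‖F l‖ ≤ C) (u : L2 Ω) :
    star (multiplier L (fun l => conj (F l)) (star u)) = multiplier L F u := by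
  obtain ⟨E, h⟩ | h := multiplier_eq_integral_or_zero L
  · have hE : ∀ t : ℝ, 0 < t → ∀ u : L2 Ω,
        E.integral (fun l => Complex.exp (-(t * (l : ℝ) : ℝ))) (star u) =
          star (E.integral (fun l => Complex.exp (-(t * (l : ℝ) : ℝ))) u) := fun t ht u => by
      rw [← h]
      exact hp.heatSemigroup_star hΩ hreal ht u
    rw [h, h, E.integral_star hE (F := fun l => conj (F l)) (C := C)
      (Complex.continuous_conj.measurable.comp hF) (fun l => by rw [RCLike.norm_conj]; exact hC l)]
    simp only [Complex.conj_conj]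
  · rw [h, h]
    have := L2.star_smul 0 (0 : L2 Ω)
    simpa using this

/-- Conjugation preserves pointwise moduli, hence both sides of the estimate. -/
theorem lintegral_le_of_star_conj {T T' : L2 Ω →L[ℂ] L2 Ω} {A v : ℝ≥0∞}
    {V : Set (EuclideanSpace ℝ (Fin n))} (hV : V ⊆ Ω) (hTT' : ∀ u, T' u = star (T (star u)))
    (hT : ∀ u : L2 Ω, MemLp u ⊤ (lebesgueOn Ω) →
      ∫⁻ x in V, ‖T u x‖ₑ ≤ A * eLpNorm u ⊤ (lebesgueOn Ω) * v)
    {u : L2 Ω} (hu : MemLp u ⊤ (lebesgueOn Ω)) :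
    ∫⁻ x in V, ‖T' u x‖ₑ ≤ A * eLpNorm u ⊤ (lebesgueOn Ω) * v := by
  have h1 := hT (star u) ((memLp_congr_ae (Lp.coeFn_star u)).2 hu.star)
  rw [eLpNorm_congr_ae (Lp.coeFn_star u), eLpNorm_star] at h1
  refine le_trans (le_of_eq ?_) h1
  refine lintegral_congr_ae ?_
  filter_upwards [ae_mono (Measure.restrict_mono_set volume hV) (Lp.coeFn_star (T (star u)))]
    with x hx
  rw [hTT', hx, Pi.star_apply, Complex.star_def, RCLike.enorm_conj]

theorem IsBoundedExtensionValue.star_conj {T T' : L2 Ω →L[ℂ] L2 Ω}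
    (hTT' : ∀ u, T' u = star (T (star u))) {f g : EuclideanSpace ℝ (Fin n) → ℂ}
    (h : IsBoundedExtensionValue Ω T (star f) g) : IsBoundedExtensionValue Ω T' f (star g) := by
  refine ⟨h.1.star, ?_⟩
  rintro u ⟨M, hM⟩ hlim R
  have hstar := ae_all_iff.2 fun k => Lp.coeFn_star (u k)
  refine (h.2 (fun k => star (u k)) ⟨M, fun k => ?_⟩ ?_ R).congr fun k => ?_
  · filter_upwards [hM k, Lp.coeFn_star (u k)] with x h1 h2
    rwa [h2, Pi.star_apply, _root_.norm_star]
  · filter_upwards [hlim, hstar] with x h1 h2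
    refine (h1.star).congr fun k => ?_
    rw [h2 k, Pi.star_apply]
  · refine lintegral_congr_ae ?_
    filter_upwards [ae_mono (Measure.restrict_mono_set volume (inter_subset_left (s := Ω)
      (t := Metric.ball 0 R))) (Lp.coeFn_star (T (star (u k))))] with x hx
    rw [hTT', hx, Pi.star_apply, Pi.star_apply, ← _root_.star_sub, Complex.star_def,
      RCLike.enorm_conj]

end Conjugation

/-! ### The bound from `L^∞` to `BMO_L` -/

section BMO

variable {n : ℕ} {Ω : Set (EuclideanSpace ℝ (Fin n))} {L : L2 Ω →ₗ.[ℂ] L2 Ω}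
  {p : ℝ → EuclideanSpace ℝ (Fin n) → EuclideanSpace ℝ (Fin n) → ℂ}

theorem L2.inGrowthClass (w : L2 Ω) : InGrowthClass Ω w := by
  refine ⟨locallyIntegrableOn_of_locallyIntegrable_restrict
    -- Any `d > 0` would do: the weight is at least 1 and `w` is square integrable.
    ((Lp.memLp w).locallyIntegrable (by norm_num)), 1, one_pos, ?_⟩
  have h2 : Integrable (fun x => ‖w x‖ ^ 2) (lebesgueOn Ω) :=
    (Lp.memLp w).integrable_norm_pow two_ne_zero
  have hpos : ∀ x : EuclideanSpace ℝ (Fin n), 0 ≤ ‖x‖ ^ ((n : ℝ) + 1) := fun x => by positivity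
  refine h2.mono' ?_ (ae_of_all _ fun x => ?_)
  · exact h2.aestronglyMeasurable.div₀ (by fun_prop : Measurable
      fun x : EuclideanSpace ℝ (Fin n) => 1 + ‖x‖ ^ ((n : ℝ) + 1)).aestronglyMeasurable
  · rw [Real.norm_of_nonneg (div_nonneg (by positivity) (by linarith [hpos x]))]
    exact div_le_self (by positivity) (by linarith [hpos x])

theorem ballMeanSup_le {h : ℝ → EuclideanSpace ℝ (Fin n) → ℂ} {A : ℝ≥0∞}
    (hA : ∀ r : ℝ, 0 < r → ∀ y ∈ Ω, ∫⁻ x in ballIn Ω y r, ‖h r x‖ₑ ≤ A * volume (ballIn Ω y r)) :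
    ballMeanSup Ω h ≤ A :=
  iSup₂_le fun y hy => iSup₂_le fun r hr => ENNReal.div_le_of_le_mul (hA r hr y hy)

/-- Uniform mean value bounds for the operators `F(L) (I - e^{-r²L})` and their extendability to
bounded functions give the bound of `F(L)` from `L^∞` to `BMO_L`. -/
theorem linftyToBMOBound_of_lintegral_le (hp : IsHeatKernel Ω L p)
    {F : ℝ≥0 → ℂ} {C A : ℝ} (hF : Measurable F) (hC : ∀ l, ‖F l‖ ≤ C)
    (hmean : ∀ r : ℝ, 0 < r → ∀ y ∈ Ω, ∀ u : L2 Ω, MemLp u ⊤ (lebesgueOn Ω) →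
      ∫⁻ x in ballIn Ω y r, ‖(multiplier L F * (1 - heatSemigroup L (r ^ 2))) u x‖ₑ ≤
        ENNReal.ofReal A * eLpNorm u ⊤ (lebesgueOn Ω) * volume (ballIn Ω y r))
    (hext : ∀ r : ℝ, 0 < r → ∀ f, MemLp f ⊤ (lebesgueOn Ω) →
      ∃ g, IsBoundedExtensionValue Ω (multiplier L F * (1 - heatSemigroup L (r ^ 2))) f g) :
    LinftyToBMOBound Ω L p F A := by
  refine ⟨fun f hf => ?_, fun f hf => ?_⟩
  · have hbound : bmoSeminorm Ω p (multiplier L F f) ≤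
        ENNReal.ofReal A * eLpNorm f ⊤ (lebesgueOn Ω) := by
      refine ballMeanSup_le fun r hr y hy => le_trans (le_of_eq ?_) (hmean r hr y hy f hf)
      -- The seminorm applies `I - e^{-r²L}` after `F(L)`, the mean bound before it; the two
      -- commute.
      have hcomm : (multiplier L F * (1 - heatSemigroup L (r ^ 2))) f =
          multiplier L F f - heatSemigroup L (r ^ 2) (multiplier L F f) := by
        rw [(multiplier_commute_heatSemigroup L hF hC (sq_nonneg r)).eq]
        rfl
      rw [hcomm]
      refine lintegral_congr_ae ?_
      have hle : (volume.restrict (ballIn Ω y r)) ≤ lebesgueOn Ω :=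
        Measure.restrict_mono_set volume inter_subset_left
      filter_upwards [ae_mono hle (Lp.coeFn_sub (multiplier L F f)
        (heatSemigroup L (r ^ 2) (multiplier L F f))),
        ae_mono hle ((hp (r ^ 2) (by positivity)).2 (multiplier L F f))] with x h1 h2
      rw [h1, Pi.sub_apply, h2]
      rfl
    exact ⟨⟨L2.inGrowthClass _,
      hbound.trans_lt (ENNReal.mul_lt_top ENNReal.ofReal_lt_top hf.2)⟩, hbound⟩
  · choose g hg using fun (r : ℝ) (hr : 0 < r) => hext r hr f hf
    -- The value 0 for `r ≤ 0` is immaterial, as only positive radii enter the supremum.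
    refine ⟨fun r => if hr : 0 < r then g r hr else 0, fun r hr => ?_, ?_⟩
    · simp only [dif_pos hr]
      exact hg r hr
    · refine ballMeanSup_le fun r hr y hy => ?_
      simp only [dif_pos hr]
      exact (hg r hr).lintegral_le (hmean r hr y hy) hf

end BMO

end

/-! ### The theorem -/

theorem theorem7p1 (D : ℝ) :
    ∃ c : ℝ, 0 < c ∧
      ∀ (n : ℕ) (Ω : Set (EuclideanSpace ℝ (Fin n))), IsOpen Ω → IsDoubling Ω D →
      ∀ L : L2 Ω →ₗ.[ℂ] L2 Ω, IsSelfAdjoint L →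
        (∀ f : L.domain, 0 ≤ (inner ℂ (L f) (f : L2 Ω)).re) →
      ∀ p : ℝ → EuclideanSpace ℝ (Fin n) → EuclideanSpace ℝ (Fin n) → ℂ,
        IsHeatKernel Ω L p → HasGaussianBound Ω p →
      ∀ (F : ℝ≥0 → ℂ) (C₁ : ℝ), Measurable F → (∀ l, ‖F l‖ ≤ C₁) →
      ∀ K : ℝ → EuclideanSpace ℝ (Fin n) → EuclideanSpace ℝ (Fin n) → ℂ,
        (∀ r : ℝ, 0 < r →
          IsSingularKernel Ω (multiplier L F * (1 - heatSemigroup L (r ^ 2))) (K r)) →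
        (∀ r : ℝ, 0 < r → ∀ y ∈ Ω,
          ∫⁻ x in Ω \ ballIn Ω y r, ‖K r x y‖ₑ ≤ ENNReal.ofReal C₁) →
      (((∀ t : ℝ, 0 < t → ∀ x ∈ Ω, ∀ y ∈ Ω, (p t x y).im = 0) ∨ (∀ l, (F l).im = 0)) →
        LinftyToBMOBound Ω L p F (c * C₁)) ∧
      LinftyToBMOBound Ω L p (fun l => conj (F l)) (c * C₁) := by
  -- The term `2√D` is the near part, with operator norm `2C₁` and doubling; the 1 is the far part,
  -- and it keeps the constant positive for every `D`.
  refine ⟨2 * Real.sqrt D + 1, by positivity, ?_⟩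
  intro n Ω hΩ hD L _ _ p hp _ F C₁ hF hC K hK hKC
  have hC0 : 0 ≤ C₁ := (norm_nonneg _).trans (hC 0)
  have hFc : Measurable fun l => conj (F l) := Complex.continuous_conj.measurable.comp hF
  have hCc : ∀ l, ‖conj (F l)‖ ≤ C₁ := fun l => by rw [RCLike.norm_conj]; exact hC l
  have hoff : ∀ r : ℝ, 0 < r → HasOffDiagonalKernel Ω
      (multiplier L F * (1 - heatSemigroup L (r ^ 2))) (K r) r (ENNReal.ofReal C₁) := fun r hr =>
    ⟨hΩ, hK r hr, hr, ENNReal.ofReal_ne_top, hKC r hr⟩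
  have hconst : ENNReal.ofReal (2 * C₁) * ENNReal.ofReal (Real.sqrt D) + ENNReal.ofReal C₁ =
      ENNReal.ofReal ((2 * Real.sqrt D + 1) * C₁) := by
    rw [← ENNReal.ofReal_mul (by positivity), ← ENNReal.ofReal_add (by positivity) hC0]
    congr 1
    ring
  have hmean : ∀ r : ℝ, 0 < r → ∀ y ∈ Ω, ∀ u : L2 Ω, MemLp u ⊤ (lebesgueOn Ω) →
      ∫⁻ x in ballIn Ω y r,
        ‖(multiplier L (fun l => conj (F l)) * (1 - heatSemigroup L (r ^ 2))) u x‖ₑ ≤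
        ENNReal.ofReal ((2 * Real.sqrt D + 1) * C₁) * eLpNorm u ⊤ (lebesgueOn Ω) *
          volume (ballIn Ω y r) := fun r hr y hy u hu => by
    rw [← adjoint_multiplier_mul L hF hC (sq_nonneg r), ← hconst]
    refine (hoff r hr).lintegral_adjoint_le hD ?_ hu hy
    rw [← ofReal_norm]
    exact ENNReal.ofReal_le_ofReal (norm_multiplier_mul_le L hF hC (sq_nonneg r))
  have hext : ∀ r : ℝ, 0 < r → ∀ f, MemLp f ⊤ (lebesgueOn Ω) →
      ∃ g, IsBoundedExtensionValue Ω
        (multiplier L (fun l => conj (F l)) * (1 - heatSemigroup L (r ^ 2))) f g :=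
    fun r hr f hf => by
      rw [← adjoint_multiplier_mul L hF hC (sq_nonneg r)]
      exact (hoff r hr).exists_isBoundedExtensionValue hf
  have hadj := linftyToBMOBound_of_lintegral_le hp hFc hCc hmean hext
  refine ⟨?_, hadj⟩
  rintro (hreal | hreal)
  -- Real heat kernel: conjugation intertwines the operator of `F` with that of `F̄`, so both inputs
  -- of part 2 carry over.
  · have hconj : ∀ (r : ℝ), 0 < r → ∀ u : L2 Ω,
        (multiplier L F * (1 - heatSemigroup L (r ^ 2))) u =
        star ((multiplier L (fun l => conj (F l)) * (1 - heatSemigroup L (r ^ 2))) (star u)) := by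
      intro r hr u
      have h1 : (1 - heatSemigroup L (r ^ 2)) (star u) =
          star ((1 - heatSemigroup L (r ^ 2)) u) := by
        change star u - heatSemigroup L (r ^ 2) (star u) = star (u - heatSemigroup L (r ^ 2) u)
        rw [hp.heatSemigroup_star hΩ hreal (by positivity)]
        have h2 := L2.star_add (u - heatSemigroup L (r ^ 2) u) (heatSemigroup L (r ^ 2) u)
        rw [sub_add_cancel] at h2
        rw [h2, add_sub_cancel_right]
      change multiplier L F ((1 - heatSemigroup L (r ^ 2)) u) = star (multiplier L
        (fun l => conj (F l)) ((1 - heatSemigroup L (r ^ 2)) (star u)))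
      rw [h1, hp.multiplier_star hΩ hreal hF hC]
    refine linftyToBMOBound_of_lintegral_le hp hF hC (fun r hr y hy u hu => ?_)
      fun r hr f hf => ?_
    · exact lintegral_le_of_star_conj inter_subset_left (hconj r hr) (hmean r hr y hy) hu
    · obtain ⟨g, hg⟩ := hext r hr (star f) hf.star
      exact ⟨star g, hg.star_conj (hconj r hr)⟩
  · have : (fun l => conj (F l)) = F := funext fun l => Complex.conj_eq_iff_im.2 (hreal l)
    rwa [this] at hadj
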